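/- Let $G$ be a finite simple graph with vertex set $V$, let $k$ be any field, let $R = k[x_v : v\in V]$ and let $I(G)\subseteq R$ be the ideal generated by the monomials $x_ux_v$ with $\{u,v\}$ an edge of $G$. Regard $k$ as the $R$-module $R/\langle x_v : v\in V\rangle$. The $R$-module $\mathrm{Tor}_i^R(R/I(G),k)$ is $\mathbb{N}^V$-graded, and for $i,d\in\mathbb{N}$ put $$\beta_{i,d}(G)=\sum_{\mathbf a\in\mathbb{N}^V,\ \sum_v a_v=d}\dim_k\big(\mathrm{Tor}_i^R(R/I(G),k)\big)_{\mathbf a},$$ where $\mathrm{Tor}$ with its grading is the homology of $F_\bullet\otimes_R k$ for an $\mathbb{N}^V$-graded resolution $F_\bullet$ of $R/I(G)$ by finitely generated free modules with maps homogeneous of degree $0$. Theorem. For every $i\ge 1$, the number $\beta_{i,2i}(G)$, computed from any such resolution, equals the number of induced subgraphs of $G$ that consist of $i$ pairwise disjoint edges (that is, induced subgraphs with exactly $i$ edges in which every vertex lies on exactly one edge). In particular it does not depend on $k$ or on the resolution. -/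

import Mathlib

noncomputable section

namespace GraphBetti

open MvPolynomial
open scoped TensorProduct

universe u v w

section Grading

variable {V : Type u} {k : Type v} [Field k]

/-- The edge ideal (graph ideal) `I(G)` in `k[x_v : v ∈ V]`, generated by the monomials
`x_u x_v` with `{u, v}` an edge of `G`. -/
def edgeIdeal (k : Type v) [Field k] (G : SimpleGraph V) : Ideal (MvPolynomial V k) :=
  Ideal.span {p | ∃ a b : V, G.Adj a b ∧ p = X a * X b}

/-- The ideal `⟨x_v : v ∈ V⟩`; the field `k`, as a module over `k[x_v : v ∈ V]`, is the quotient
by this ideal. -/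
def irrelevantIdeal (V : Type u) (k : Type v) [Field k] : Ideal (MvPolynomial V k) :=
  Ideal.span (Set.range X)

/-- The component of multidegree `a` of the polynomial ring: the `k`-line spanned by `x^a`. -/
def polyPart (V : Type u) (k : Type v) [Field k] (a : V →₀ ℕ) :
    Submodule k (MvPolynomial V k) :=
  Submodule.span k {monomial a 1}

/-- The component of multidegree `a` of `k[x_v : v ∈ V] / J`. -/
def quotPart (J : Ideal (MvPolynomial V k)) (a : V →₀ ℕ) :
    Submodule k (MvPolynomial V k ⧸ J) :=
  (polyPart V k a).map (Ideal.Quotient.mkₐ k J).toLinearMap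

/-- The component of multidegree `a` of the shifted module `R(-c)`, spanned over `k` by the `x^b`
with `c + b = a`. -/
def shiftPart (k : Type v) [Field k] (c a : V →₀ ℕ) : Submodule k (MvPolynomial V k) :=
  Submodule.span k {p | ∃ b : V →₀ ℕ, c + b = a ∧ p = monomial b 1}

/-- The component of multidegree `a` of the graded free module `⨁ j, R(-deg j)`, that is, of the
free `R`-module with finite basis `(e_j)` in which `e_j` has multidegree `deg j`. -/
def freePart (k : Type v) [Field k] {ι : Type w} (deg : ι → V →₀ ℕ) (a : V →₀ ℕ) :
    Submodule k (ι → MvPolynomial V k) :=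
  Submodule.pi Set.univ fun j => shiftPart k (deg j) a

end Grading

/-- An `ℕ^V`-graded resolution of `R / I` (`R = k[x_v : v ∈ V]`) by finitely generated free
modules: the `n`-th module is free with basis indexed by `ι n`, the `j`-th basis element having
multidegree `deg n j`, and all maps are homogeneous of degree `0`. -/
structure MultigradedFreeResolution {V : Type u} {k : Type v} [Field k]
    (I : Ideal (MvPolynomial V k)) where
  ι : ℕ → Type w
  finite_ι : ∀ n, Finite (ι n)
  deg : ∀ n, ι n → V →₀ ℕ
  d : ∀ n, (ι (n + 1) → MvPolynomial V k) →ₗ[MvPolynomial V k] (ι n → MvPolynomial V k)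
  aug : (ι 0 → MvPolynomial V k) →ₗ[MvPolynomial V k] (MvPolynomial V k ⧸ I)
  d_homogeneous : ∀ n a, ∀ f ∈ freePart k (deg (n + 1)) a, d n f ∈ freePart k (deg n) a
  aug_homogeneous : ∀ a, ∀ f ∈ freePart k (deg 0) a, aug f ∈ quotPart I a
  aug_surjective : Function.Surjective aug
  exact_zero : Function.Exact (d 0) aug
  exact_succ : ∀ n, Function.Exact (d (n + 1)) (d n)

namespace MultigradedFreeResolution

variable {V : Type u} {k : Type v} [Field k] {I : Ideal (MvPolynomial V k)}
  (F : MultigradedFreeResolution.{u, v, w} I)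

/-- The `n`-th module `F_n ⊗_R k` of the complex `F ⊗_R k`. -/
abbrev tensorObj (n : ℕ) : Type (max u v w) :=
  (F.ι n → MvPolynomial V k) ⊗[MvPolynomial V k] (MvPolynomial V k ⧸ irrelevantIdeal V k)

/-- The differential `F_{n+1} ⊗_R k → F_n ⊗_R k`. -/
def tensorD (n : ℕ) : F.tensorObj (n + 1) →ₗ[MvPolynomial V k] F.tensorObj n :=
  (F.d n).rTensor (MvPolynomial V k ⧸ irrelevantIdeal V k)

/-- The component of multidegree `a` of `F_n ⊗_R k`, spanned over `k` by the `f ⊗ c` with `f`, `c`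
homogeneous of multidegrees adding up to `a`. -/
def tensorPart (n : ℕ) (a : V →₀ ℕ) : Submodule k (F.tensorObj n) :=
  Submodule.span k {t | ∃ (b c : V →₀ ℕ) (f : F.ι n → MvPolynomial V k)
    (s : MvPolynomial V k ⧸ irrelevantIdeal V k), b + c = a ∧
      f ∈ freePart k (F.deg n) b ∧ s ∈ quotPart (irrelevantIdeal V k) c ∧ t = f ⊗ₜ s}

/-- The cycles in `F_n ⊗_R k`. -/
def cycles : ∀ n : ℕ, Submodule (MvPolynomial V k) (F.tensorObj n)
  | 0 => ⊤
  | n + 1 => LinearMap.ker (F.tensorD n)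

/-- The boundaries in `F_n ⊗_R k`. -/
def boundaries (n : ℕ) : Submodule (MvPolynomial V k) (F.tensorObj n) :=
  LinearMap.range (F.tensorD n)

/-- `Tor_n^R(R / I, k)`, the `n`-th homology (cycles modulo boundaries) of `F ⊗_R k`, as a
submodule of `F_n ⊗_R k` modulo boundaries. -/
def tor (n : ℕ) : Submodule (MvPolynomial V k) (F.tensorObj n ⧸ F.boundaries n) :=
  (F.cycles n).map (F.boundaries n).mkQ

/-- The component of multidegree `a` of `Tor_n^R(R / I, k)`: the classes of the cycles of
multidegree `a`. -/
def torPart (n : ℕ) (a : V →₀ ℕ) : Submodule k (F.tensorObj n ⧸ F.boundaries n) :=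
  ((F.cycles n).restrictScalars k ⊓ F.tensorPart n a).map
    ((F.boundaries n).mkQ.restrictScalars k)

/-- `β_{i,a} = dim_k Tor_i^R(R / I, k)_a` for a multidegree `a`. -/
def multigradedBetti (i : ℕ) (a : V →₀ ℕ) : ℕ :=
  Module.finrank k (F.torPart i a)

/-- `β_{i,d}`, the sum of the `β_{i,a}` over all `a : V → ℕ` with `∑ v, a v = d`. -/
def gradedBetti [Fintype V] [DecidableEq V] (i d : ℕ) : ℕ :=
  ∑ a ∈ (Finset.univ : Finset V).finsuppAntidiag d, F.multigradedBetti i a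

end MultigradedFreeResolution

/-! ### Existence of multigraded free resolutions -/

section Existence

variable {V : Type u} {k : Type v} [Field k]

open Classical in
/-- The projection of `R(-c)` to its component of multidegree `a`. -/
def shiftComp (k : Type v) [Field k] (c a : V →₀ ℕ) : MvPolynomial V k →ₗ[k] MvPolynomial V k :=
  if c ≤ a then (monomial (a - c) : k →ₗ[k] _) ∘ₗ lcoeff k (a - c) else 0

/-- The projection of a graded free module to its component of multidegree `a`. -/
def comp (k : Type v) [Field k] {ι : Type w} (deg : ι → V →₀ ℕ) (a : V →₀ ℕ) :
    (ι → MvPolynomial V k) →ₗ[k] (ι → MvPolynomial V k) :=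
  LinearMap.pi fun j => shiftComp k (deg j) a ∘ₗ LinearMap.proj j

open Classical in
lemma shiftComp_monomial (c a b : V →₀ ℕ) (r : k) :
    shiftComp k c a (monomial b r) = if c + b = a then monomial b r else 0 := by
  unfold shiftComp
  by_cases h : c ≤ a
  · obtain ⟨e, rfl⟩ := exists_add_of_le h
    simp only [h, if_true, add_tsub_cancel_left, LinearMap.comp_apply, lcoeff_apply,
      coeff_monomial, add_right_inj]
    by_cases hb : b = e <;> simp [hb]
  · have : c + b ≠ a := by
      rintro rfl
      exact h le_self_add
    simp [h, this]

open Classical in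
lemma shiftComp_of_mem (c a b : V →₀ ℕ) (f : MvPolynomial V k)
    (hf : f ∈ shiftPart k c b) : shiftComp k c a f = if b = a then f else 0 := by
  unfold shiftPart at hf
  induction hf using Submodule.span_induction with
  | mem x hx =>
    obtain ⟨e, rfl, rfl⟩ := hx
    exact shiftComp_monomial c a e 1
  | zero => simp
  | add x y _ _ hx hy => rw [map_add, hx, hy]; split_ifs <;> simp
  | smul r x _ hx => rw [map_smul, hx]; split_ifs <;> simp

lemma monomial_mem (c b : V →₀ ℕ) (r : k) : monomial b r ∈ shiftPart k c (c + b) := by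
  have : (monomial b r : MvPolynomial V k) = r • monomial b 1 := by
    rw [smul_monomial, smul_eq_mul, mul_one]
  rw [this]
  exact Submodule.smul_mem _ _ (Submodule.subset_span ⟨b, rfl, rfl⟩)

lemma shiftComp_mem (c a : V →₀ ℕ) (f : MvPolynomial V k) :
    shiftComp k c a f ∈ shiftPart k c a := by
  classical
  induction f using MvPolynomial.induction_on' with
  | add f g hf hg => rw [map_add]; exact add_mem hf hg
  | monomial b r =>
    rw [shiftComp_monomial]
    split_ifs with h
    · subst h; exact monomial_mem c b r
    · exact zero_mem _

lemma sum_shiftComp (c : V →₀ ℕ) (f : MvPolynomial V k) :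
    ∃ s : Finset (V →₀ ℕ), ∀ t, s ⊆ t → ∑ a ∈ t, shiftComp k c a f = f := by
  classical
  induction f using MvPolynomial.induction_on' with
  | add f g hf hg =>
    obtain ⟨s, hs⟩ := hf
    obtain ⟨s', hs'⟩ := hg
    refine ⟨s ∪ s', fun t ht => ?_⟩
    simp only [map_add, Finset.sum_add_distrib]
    rw [hs t (Finset.union_subset_left ht), hs' t (Finset.union_subset_right ht)]
  | monomial b r =>
    refine ⟨{c + b}, fun t ht => ?_⟩
    simp only [shiftComp_monomial]
    rw [Finset.sum_ite_eq, if_pos (ht (Finset.mem_singleton_self _))]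

lemma comp_mem {ι : Type w} (deg : ι → V →₀ ℕ) (a : V →₀ ℕ) (f : ι → MvPolynomial V k) :
    comp k deg a f ∈ freePart k deg a :=
  fun j _ => shiftComp_mem (deg j) a (f j)

open Classical in
lemma comp_of_mem {ι : Type w} (deg : ι → V →₀ ℕ) (a b : V →₀ ℕ) (f : ι → MvPolynomial V k)
    (hf : f ∈ freePart k deg b) : comp k deg a f = if b = a then f else 0 := by
  funext j
  have := shiftComp_of_mem (deg j) a b (f j) (hf j trivial)
  refine Eq.trans this ?_
  split_ifs <;> rfl

/-- Every element is the sum of its components. -/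
lemma sum_comp {ι : Type w} [Finite ι] (deg : ι → V →₀ ℕ) (f : ι → MvPolynomial V k) :
    ∃ s : Finset (V →₀ ℕ), ∀ t, s ⊆ t → ∑ a ∈ t, comp k deg a f = f := by
  classical
  cases nonempty_fintype ι
  choose s hs using fun j => sum_shiftComp (deg j) (f j)
  refine ⟨Finset.univ.biUnion s, fun t ht => ?_⟩
  funext j
  rw [Finset.sum_apply]
  exact hs j t ((Finset.subset_biUnion_of_mem s (Finset.mem_univ j)).trans ht)

lemma comp_comm {ι ι' : Type w} [Finite ι] (deg : ι → V →₀ ℕ) (deg' : ι' → V →₀ ℕ)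
    (φ : (ι → MvPolynomial V k) →ₗ[MvPolynomial V k] (ι' → MvPolynomial V k))
    (hφ : ∀ a, ∀ f ∈ freePart k deg a, φ f ∈ freePart k deg' a) (a : V →₀ ℕ)
    (f : ι → MvPolynomial V k) : comp k deg' a (φ f) = φ (comp k deg a f) := by
  classical
  obtain ⟨s, hs⟩ := sum_comp deg f
  conv_lhs => rw [← hs (insert a s) (Finset.subset_insert a s)]
  rw [map_sum, map_sum]
  simp only [fun b => comp_of_mem deg' a b _ (hφ b _ (comp_mem deg b f))]
  rw [Finset.sum_ite_eq', if_pos (Finset.mem_insert_self a s)]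

/-- A graded free module of finite rank with a homogeneous submodule. -/
structure GradedSub (V : Type u) (k : Type v) [Field k] where
  r : ℕ
  deg : Fin r → V →₀ ℕ
  K : Submodule (MvPolynomial V k) (Fin r → MvPolynomial V k)
  hK : ∀ a, ∀ f ∈ K, comp k deg a f ∈ K

lemma GradedSub.exists_cover [Finite V] (S : GradedSub V k) :
    ∃ (r : ℕ) (deg : Fin r → V →₀ ℕ)
      (φ : (Fin r → MvPolynomial V k) →ₗ[MvPolynomial V k] (Fin S.r → MvPolynomial V k)),
      LinearMap.range φ = S.K ∧
        ∀ a, ∀ f ∈ freePart k deg a, φ f ∈ freePart k S.deg a := by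
  classical
  set T : Set (Fin S.r → MvPolynomial V k) := {f | f ∈ S.K ∧ ∃ a, f ∈ freePart k S.deg a}
  have hspan : Submodule.span (MvPolynomial V k) T = S.K := by
    apply le_antisymm
    · exact Submodule.span_le.2 fun f hf => hf.1
    · intro f hf
      obtain ⟨s, hs⟩ := sum_comp S.deg f
      rw [← hs s subset_rfl]
      exact Submodule.sum_mem _ fun a _ =>
        Submodule.subset_span ⟨S.hK a f hf, a, comp_mem S.deg a f⟩
  have hfg : (Submodule.span (MvPolynomial V k) T).FG := IsNoetherian.noetherian _
  obtain ⟨U, hUT, hU⟩ := Submodule.fg_span_iff_fg_span_finset_subset T |>.1 hfg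
  choose! dg hdg using fun f (hf : f ∈ T) => hf.2
  let e := U.equivFin.symm
  let g : Fin U.card → (Fin S.r → MvPolynomial V k) := fun j => (e j : _)
  refine ⟨U.card, fun j => dg (g j), Fintype.linearCombination _ g, ?_, ?_⟩
  · rw [Fintype.range_linearCombination, ← hspan, hU]
    congr 1
    ext x
    constructor
    · rintro ⟨j, rfl⟩
      exact (e j).2
    · intro hx
      exact ⟨e.symm ⟨x, hx⟩, by simp [g]⟩
  · intro a f hf
    rw [Fintype.linearCombination_apply]
    refine Submodule.sum_mem _ fun j _ i _ => ?_
    have hfj : f j ∈ shiftPart k (dg (g j)) a := hf j trivial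
    have hgj : g j i ∈ shiftPart k (S.deg i) (dg (g j)) := hdg (g j) (hUT (e j).2) i trivial
    rw [Pi.smul_apply, smul_eq_mul]
    generalize f j = p at hfj
    generalize g j i = q at hgj
    generalize dg (g j) = c at hfj hgj
    unfold shiftPart at hfj hgj
    induction hfj, hgj using Submodule.span_induction₂ with
    | mem_mem x y hx hy =>
      obtain ⟨b, rfl, rfl⟩ := hx
      obtain ⟨b', rfl, rfl⟩ := hy
      rw [monomial_mul, mul_one, add_comm b b', add_assoc]
      exact monomial_mem _ _ _
    | zero_left y _ => simp
    | zero_right x _ => simp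
    | add_left x y z _ _ _ hx hy => rw [add_mul]; exact add_mem hx hy
    | add_right x y z _ _ _ hx hy => rw [mul_add]; exact add_mem hx hy
    | smul_left r x y _ _ h => rw [smul_mul_assoc]; exact Submodule.smul_mem _ _ h
    | smul_right r x y _ _ h => rw [mul_smul_comm]; exact Submodule.smul_mem _ _ h

/-- The kernel of a homogeneous surjection from a graded free module onto the given submodule. -/
def GradedSub.next [Finite V] (S : GradedSub V k) : GradedSub V k where
  r := S.exists_cover.choose
  deg := S.exists_cover.choose_spec.choose
  K := LinearMap.ker S.exists_cover.choose_spec.choose_spec.choose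
  hK a f hf := by
    rw [LinearMap.mem_ker] at hf ⊢
    rw [← comp_comm _ _ _ S.exists_cover.choose_spec.choose_spec.choose_spec.2, hf, map_zero]

/-- The syzygies of a homogeneous submodule. -/
def GradedSub.seq [Finite V] (S : GradedSub V k) : ℕ → GradedSub V k
  | 0 => S
  | n + 1 => (GradedSub.seq S n).next

/-- The ring as a free module of rank one, with the submodule `I`. -/
def GradedSub.ofIdeal (I : Ideal (MvPolynomial V k))
    (hI : ∀ f ∈ I, ∀ a, monomial a (coeff a f) ∈ I) : GradedSub V k where
  r := 1
  deg _ := 0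
  K := LinearMap.ker ((Submodule.mkQ I) ∘ₗ LinearMap.proj (0 : Fin 1))
  hK a f hf := by
    rw [LinearMap.mem_ker, LinearMap.comp_apply, Submodule.mkQ_apply,
      Submodule.Quotient.mk_eq_zero, LinearMap.proj_apply] at hf ⊢
    change shiftComp k 0 a (f 0) ∈ I
    rw [shiftComp, if_pos zero_le]
    simpa using hI _ hf a

theorem MultigradedFreeResolution.nonempty [Finite V] (I : Ideal (MvPolynomial V k))
    (hI : ∀ f ∈ I, ∀ a, monomial a (coeff a f) ∈ I) :
    Nonempty (MultigradedFreeResolution.{u, v, 0} I) := by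
  let S := (GradedSub.ofIdeal I hI).seq
  refine ⟨{
    ι := fun n => Fin (S n).r
    finite_ι := fun n => inferInstance
    deg := fun n => (S n).deg
    d := fun n => (S n).exists_cover.choose_spec.choose_spec.choose
    aug := (Submodule.mkQ I) ∘ₗ LinearMap.proj (0 : Fin 1)
    d_homogeneous := fun n => (S n).exists_cover.choose_spec.choose_spec.choose_spec.2
    aug_homogeneous := ?_
    aug_surjective := ?_
    exact_zero := ?_
    exact_succ := ?_ }⟩
  · intro a f hf
    have h0 : f (0 : Fin 1) ∈ shiftPart k 0 a := hf (0 : Fin 1) trivial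
    have h1 : shiftPart k 0 a = polyPart V k a := by
      unfold shiftPart polyPart
      congr 1
      ext p
      simp
    exact ⟨f (0 : Fin 1), h1 ▸ h0, rfl⟩
  · intro y
    obtain ⟨p, rfl⟩ := Submodule.mkQ_surjective I y
    exact ⟨fun _ => p, rfl⟩
  · exact (LinearMap.exact_iff (M := Fin (S 0).next.r → MvPolynomial V k) (N := Fin (S 0).r → MvPolynomial V k)).2
      (S 0).exists_cover.choose_spec.choose_spec.choose_spec.1.symm
  · intro n
    exact (LinearMap.exact_iff (M := Fin (S (n + 1)).next.r → MvPolynomial V k)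
      (N := Fin (S (n + 1)).r → MvPolynomial V k)).2
      (S (n + 1)).exists_cover.choose_spec.choose_spec.choose_spec.1.symm

lemma edgeIdeal_homogeneous (G : SimpleGraph V) (f : MvPolynomial V k)
    (hf : f ∈ edgeIdeal k G) (a : V →₀ ℕ) : monomial a (coeff a f) ∈ edgeIdeal k G := by
  classical
  have h : edgeIdeal k G = Ideal.span ((fun s => monomial s (1 : k)) ''
      {s | ∃ x y : V, G.Adj x y ∧ s = Finsupp.single x 1 + Finsupp.single y 1}) := by
    unfold edgeIdeal
    congr 1
    ext p
    constructor
    · rintro ⟨x, y, hxy, rfl⟩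
      exact ⟨_, ⟨x, y, hxy, rfl⟩, by simp [X, monomial_mul]⟩
    · rintro ⟨_, ⟨x, y, hxy, rfl⟩, rfl⟩
      exact ⟨x, y, hxy, by simp [X, monomial_mul]⟩
  rw [h, mem_ideal_span_monomial_image] at hf ⊢
  intro b hb
  by_cases h0 : coeff a f = 0
  · simp [h0] at hb
  · have hba : b = a := by
      have := support_monomial_subset hb
      simpa using this
    subst hba
    exact hf b (mem_support_iff.2 h0)

end Existence

/-- The graded Betti number `β_{i,d}(G) = dim_k Tor_i^R(R / I(G), k)_d` of the graph `G` over the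
field `k`, computed from a multigraded free resolution of `R / I(G)`. -/
def graphBetti {V : Type u} [Fintype V] [DecidableEq V] (k : Type v) [Field k]
    (G : SimpleGraph V) (i d : ℕ) : ℕ :=
  (Classical.choice
    (MultigradedFreeResolution.nonempty (edgeIdeal k G) (edgeIdeal_homogeneous G))).gradedBetti i d

/-- The induced subgraphs of `G` which are `i` pairwise disjoint edges: every vertex of `H` lies
in exactly one edge of `H`, and `H` has exactly `i` edges. -/
def inducedDisjointEdges {V : Type u} (G : SimpleGraph V) (i : ℕ) : Set G.Subgraph :=
  {H | H.IsInduced ∧ H.IsMatching ∧ H.edgeSet.ncard = i}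

end GraphBetti

end

/-! Multigraded Betti numbers do not depend on the resolution: two graded free resolutions are
joined by homogeneous chain maps that are mutually inverse up to homotopy, and these survive
reduction modulo the variables (`multigradedBetti_eq_of_resolution`). So they may be read off from
the Taylor resolution on the generators of `I(G)`, whose basis elements `e_σ` in homological degree
`i` are indexed by sets `σ` of `i` edges, placed in the multidegree of the lcm of the corresponding
monomials.

The generators have degree two, so the lcm over `σ` has degree at most `2 * i`, with equality
exactly when it equals the product, that is, when the edges of `σ` are pairwise disjoint. On this
extremal diagonal the reduced Taylor complex is almost trivial. Every element is a cycle, since `i -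
1` edges reach degree at most `2 * i - 2` (`taylor_resCyclesPart`). A set `τ` of `i + 1` edges whose
lcm has degree `2 * i` has at most one face with the same lcm: the removed monomial must be the
product over `τ` divided by the lcm (`eq_of_lcmExp_erase_eq`). Hence each such `e_τ` has as reduced
boundary either zero or a signed basis element, and the boundaries are spanned by the `e_σ` for
which some further edge divides the lcm of `σ` (`residuePart_inf_range_taylorDiff`).

The Betti number therefore counts the sets of `i` pairwise disjoint edges such that no other edge of
`G` has both ends among their endpoints. These are the induced matchings, whatever the field. -/

noncomputable section

namespace GraphBetti

open MvPolynomial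
open scoped TensorProduct

universe u v w w' w''

/-! ### Reduction of graded free modules modulo the variables, in coordinates. -/

section Residue

variable {V : Type u} {k : Type v} [Field k] {ι : Type w} {ι' : Type w'} {ι'' : Type w''}

/-- Reduction of a free module modulo the irrelevant ideal: constant terms of all coordinates. -/
def residue (V : Type u) (k : Type v) [Field k] (ι : Type w) :
    (ι → MvPolynomial V k) →ₗ[k] (ι → k) :=
  LinearMap.pi fun j => lcoeff k 0 ∘ₗ LinearMap.proj j

/-- The constant vectors in a free module. -/
def constVec (V : Type u) (k : Type v) [Field k] (ι : Type w) :
    (ι → k) →ₗ[k] (ι → MvPolynomial V k) :=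
  LinearMap.pi fun j => (Algebra.linearMap k (MvPolynomial V k)) ∘ₗ LinearMap.proj j

@[simp]
lemma residue_apply (f : ι → MvPolynomial V k) (j : ι) :
    residue V k ι f j = constantCoeff (f j) := rfl

@[simp]
lemma constVec_apply (x : ι → k) (j : ι) : constVec V k ι x j = C (x j) := rfl

@[simp]
lemma residue_constVec (x : ι → k) : residue V k ι (constVec V k ι x) = x := by
  ext j
  simp

lemma residue_smul (p : MvPolynomial V k) (f : ι → MvPolynomial V k) :
    residue V k ι (p • f) = constantCoeff p • residue V k ι f := by
  ext j
  simp

/-- The map induced modulo the irrelevant ideal by a map of free modules. -/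
def residueMap (φ : (ι → MvPolynomial V k) →ₗ[MvPolynomial V k] (ι' → MvPolynomial V k)) :
    (ι → k) →ₗ[k] (ι' → k) :=
  residue V k ι' ∘ₗ φ.restrictScalars k ∘ₗ constVec V k ι

lemma residueMap_apply
    (φ : (ι → MvPolynomial V k) →ₗ[MvPolynomial V k] (ι' → MvPolynomial V k)) (x : ι → k) :
    residueMap φ x = residue V k ι' (φ (constVec V k ι x)) := rfl

/-- By linearity over the polynomial ring, the constant terms of `φ f` depend only on those of `f`;
finiteness of `ι` lets `f` be expanded in the basis. -/
lemma residueMap_residue [Finite ι]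
    (φ : (ι → MvPolynomial V k) →ₗ[MvPolynomial V k] (ι' → MvPolynomial V k))
    (f : ι → MvPolynomial V k) : residueMap φ (residue V k ι f) = residue V k ι' (φ f) := by
  classical
  cases nonempty_fintype ι
  rw [residueMap_apply, φ.pi_apply_eq_sum_univ f, φ.pi_apply_eq_sum_univ, map_sum, map_sum]
  simp only [residue_smul]
  simp

lemma residueMap_comp [Finite ι']
    (φ : (ι' → MvPolynomial V k) →ₗ[MvPolynomial V k] (ι'' → MvPolynomial V k))
    (ψ : (ι → MvPolynomial V k) →ₗ[MvPolynomial V k] (ι' → MvPolynomial V k)) :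
    residueMap (φ ∘ₗ ψ) = residueMap φ ∘ₗ residueMap ψ := by
  ext1 x
  rw [LinearMap.comp_apply, residueMap_apply ψ, residueMap_residue]
  rfl

lemma residueMap_id :
    residueMap (LinearMap.id : (ι → MvPolynomial V k) →ₗ[MvPolynomial V k] _) =
      LinearMap.id := by
  ext1 x
  simp [residueMap_apply]

lemma residueMap_sub
    (φ ψ : (ι → MvPolynomial V k) →ₗ[MvPolynomial V k] (ι' → MvPolynomial V k)) :
    residueMap (φ - ψ) = residueMap φ - residueMap ψ := by
  ext1 x
  simp [residueMap_apply]

/-- The vectors with all nonzero coordinates among those satisfying `p`. -/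
def coordSubspace (k : Type v) [Field k] (p : ι → Prop) : Submodule k (ι → k) where
  carrier := {x | ∀ j, x j ≠ 0 → p j}
  zero_mem' := by simp
  add_mem' {x y} hx hy j hj := by
    by_cases h : x j = 0
    · exact hy j fun h' => hj (by simp [h, h'])
    · exact hx j h
  smul_mem' r x hx j hj := hx j fun h => hj (by simp [h])

lemma finrank_coordSubspace [Fintype ι] (p : ι → Prop) [DecidablePred p] :
    Module.finrank k (coordSubspace k p) = (Finset.univ.filter p).card := by
  let e : coordSubspace k p ≃ₗ[k] ({j // p j} → k) :=
    { toFun := fun x j => x.1 j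
      map_add' := fun x y => rfl
      map_smul' := fun c x => rfl
      invFun := fun y => ⟨fun j => if h : p j then y ⟨j, h⟩ else 0, fun j hj => by
        by_contra h
        exact hj (dif_neg h)⟩
      left_inv := fun x => by
        ext j
        by_cases h : p j
        · exact dif_pos h
        · exact (dif_neg h).trans (not_not.1 fun h' => h (x.2 j fun h'' => h' h''.symm))
      right_inv := fun y => by
        ext j
        exact dif_pos j.2 }
  rw [e.finrank_eq, Module.finrank_fintype_fun_eq_card, Fintype.card_subtype]

/-- The component of multidegree `a` of a graded free module modulo the irrelevant ideal. -/
def residuePart (k : Type v) [Field k] (deg : ι → V →₀ ℕ) (a : V →₀ ℕ) : Submodule k (ι → k) :=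
  coordSubspace k fun j => deg j = a

/-- Modulo the variables only the basis elements themselves remain, so a basis element contributes
only in its own multidegree. -/
lemma eq_of_mem_shiftPart {c a : V →₀ ℕ} {f : MvPolynomial V k} (hf : f ∈ shiftPart k c a)
    (h : constantCoeff f ≠ 0) : c = a := by
  classical
  by_contra hne
  refine h ?_
  clear h
  unfold shiftPart at hf
  induction hf using Submodule.span_induction with
  | mem x hx =>
    obtain ⟨b, hb, rfl⟩ := hx
    rw [constantCoeff_monomial, if_neg]
    rintro rfl
    exact hne (by simpa using hb)
  | zero => exact map_zero _
  | add x y _ _ hx hy => rw [map_add, hx, hy, add_zero]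
  | smul r x _ hx => rw [constantCoeff_smul, hx, smul_zero]

lemma residue_mem_residuePart {deg : ι → V →₀ ℕ} {a : V →₀ ℕ} {f : ι → MvPolynomial V k}
    (hf : f ∈ freePart k deg a) : residue V k ι f ∈ residuePart k deg a :=
  fun j hj => eq_of_mem_shiftPart (hf j trivial) hj

lemma constVec_mem_freePart {deg : ι → V →₀ ℕ} {a : V →₀ ℕ} {x : ι → k}
    (hx : x ∈ residuePart k deg a) : constVec V k ι x ∈ freePart k deg a := by
  intro j _
  by_cases h : x j = 0
  · rw [constVec_apply, h, map_zero]
    exact zero_mem _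
  · rw [← hx j h]
    simpa using monomial_mem (deg j) 0 (x j)

/-- Homogeneous maps of degree `0` between graded free modules. -/
def IsHomogeneousMap (deg : ι → V →₀ ℕ) (deg' : ι' → V →₀ ℕ)
    (φ : (ι → MvPolynomial V k) →ₗ[MvPolynomial V k] (ι' → MvPolynomial V k)) : Prop :=
  ∀ a, ∀ f ∈ freePart k deg a, φ f ∈ freePart k deg' a

lemma IsHomogeneousMap.residueMap_mem {deg : ι → V →₀ ℕ} {deg' : ι' → V →₀ ℕ}
    {φ : (ι → MvPolynomial V k) →ₗ[MvPolynomial V k] (ι' → MvPolynomial V k)}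
    (hφ : IsHomogeneousMap deg deg' φ) {a : V →₀ ℕ} {x : ι → k} (hx : x ∈ residuePart k deg a) :
    residueMap φ x ∈ residuePart k deg' a :=
  residue_mem_residuePart (hφ a _ (constVec_mem_freePart hx))

/-- Rank-nullity for `f` restricted to `P`. With `P` the cycles of one multidegree and `f` the
quotient by the boundaries, it turns Betti numbers into differences of dimensions. -/
lemma finrank_map_add_finrank_inf_ker {M N : Type*} [AddCommGroup M] [Module k M]
    [AddCommGroup N] [Module k N] (P : Submodule k M) [FiniteDimensional k P] (f : M →ₗ[k] N) :
    Module.finrank k (P.map f) + Module.finrank k ↥(P ⊓ LinearMap.ker f) =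
      Module.finrank k P := by
  rw [← LinearMap.finrank_range_add_finrank_ker (f.domRestrict P), LinearMap.range_domRestrict,
    LinearMap.ker_domRestrict, ← Submodule.map_comap_subtype,
    Submodule.finrank_map_subtype_eq]

end Residue

/-! ### Identification of `F_n ⊗ k` with a coordinate space over `k`. -/

section Tensor

variable {V : Type u} {k : Type v} [Field k] {ι : Type w}

lemma mem_irrelevantIdeal {p : MvPolynomial V k} :
    p ∈ irrelevantIdeal V k ↔ constantCoeff p = 0 := by
  rw [irrelevantIdeal, ← Set.image_univ, mem_ideal_span_X_image, constantCoeff_eq]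
  constructor
  · intro h
    by_contra h0
    obtain ⟨i, -, hi⟩ := h 0 (mem_support_iff.2 h0)
    exact hi rfl
  · intro h b hb
    by_contra! hb'
    refine mem_support_iff.1 hb ?_
    rw [show b = 0 from Finsupp.ext fun i => hb' i trivial, h]

/-- The map `x ↦ x ⊗ 1` from constant vectors. -/
def constTensor (V : Type u) (k : Type v) [Field k] (ι : Type w) :
    (ι → k) →ₗ[k]
      (ι → MvPolynomial V k) ⊗[MvPolynomial V k] (MvPolynomial V k ⧸ irrelevantIdeal V k) where
  toFun x := constVec V k ι x ⊗ₜ 1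
  map_add' x y := by rw [map_add, TensorProduct.add_tmul]
  map_smul' r x := by rw [map_smul, RingHom.id_apply, TensorProduct.smul_tmul']

lemma constTensor_apply (x : ι → k) : constTensor V k ι x = constVec V k ι x ⊗ₜ 1 := rfl

/-- The difference between `f` and its constant part has entries in the irrelevant ideal; these move
across the tensor sign and vanish there. -/
lemma constTensor_residue [Finite ι] (f : ι → MvPolynomial V k) :
    constTensor V k ι (residue V k ι f) = f ⊗ₜ 1 := by
  classical
  cases nonempty_fintype ι
  rw [constTensor_apply, ← sub_eq_zero, ← TensorProduct.sub_tmul]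
  set g := constVec V k ι (residue V k ι f) - f
  have hg : ∀ j, g j ∈ irrelevantIdeal V k := fun j => by simp [g, mem_irrelevantIdeal]
  rw [pi_eq_sum_univ g, TensorProduct.sum_tmul]
  refine Finset.sum_eq_zero fun j _ => ?_
  rw [TensorProduct.smul_tmul, ← Algebra.algebraMap_eq_smul_one, Ideal.Quotient.algebraMap_eq,
    Ideal.Quotient.eq_zero_iff_mem.2 (hg j), TensorProduct.tmul_zero]

lemma constTensor_residue_smul [Finite ι] (p : MvPolynomial V k) (f : ι → MvPolynomial V k) :
    constTensor V k ι (residue V k ι (p • f)) =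
      f ⊗ₜ Ideal.Quotient.mk (irrelevantIdeal V k) p := by
  rw [constTensor_residue, TensorProduct.smul_tmul, ← Algebra.algebraMap_eq_smul_one,
    Ideal.Quotient.algebraMap_eq]

lemma constTensor_injective : Function.Injective (constTensor V k ι) := by
  rw [injective_iff_map_eq_zero]
  intro x hx
  ext j
  -- Tensoring the `j`-th coordinate functional with `k` recovers `x j` modulo the variables.
  have h := congrArg ((TensorProduct.lid (MvPolynomial V k)
    (MvPolynomial V k ⧸ irrelevantIdeal V k)).toLinearMap ∘ₗ
      (LinearMap.proj (R := MvPolynomial V k) (φ := fun _ : ι => MvPolynomial V k) j).rTensor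
        (MvPolynomial V k ⧸ irrelevantIdeal V k)) hx
  simp only [constTensor_apply, LinearMap.comp_apply, LinearMap.rTensor_tmul,
    LinearMap.proj_apply, constVec_apply, LinearEquiv.coe_coe, TensorProduct.lid_tmul,
    map_zero, ← Algebra.algebraMap_eq_smul_one, Ideal.Quotient.algebraMap_eq,
    Ideal.Quotient.eq_zero_iff_mem, mem_irrelevantIdeal, constantCoeff_C] at h
  exact h

lemma constTensor_surjective [Finite ι] : Function.Surjective (constTensor V k ι) := by
  intro t
  rw [← LinearMap.mem_range]
  induction t with
  | zero => exact zero_mem _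
  | add x y hx hy => exact add_mem hx hy
  | tmul f s =>
    obtain ⟨p, rfl⟩ := Ideal.Quotient.mk_surjective s
    exact ⟨_, constTensor_residue_smul p f⟩

end Tensor

/-! ### Cycles, boundaries and Betti numbers in coordinates. -/

namespace MultigradedFreeResolution

variable {V : Type u} {k : Type v} [Field k] {I : Ideal (MvPolynomial V k)}
  (F : MultigradedFreeResolution.{u, v, w} I)

instance (n : ℕ) : Finite (F.ι n) := F.finite_ι n

/-- The differential of `F ⊗ k` in coordinates. -/
def resD (n : ℕ) : (F.ι (n + 1) → k) →ₗ[k] (F.ι n → k) := residueMap (F.d n)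

/-- The cycles of `F ⊗ k` in coordinates. -/
def resCycles : ∀ n : ℕ, Submodule k (F.ι n → k)
  | 0 => ⊤
  | n + 1 => LinearMap.ker (F.resD n)

/-- The cycles of multidegree `a` of `F ⊗ k` in coordinates. -/
def resCyclesPart (n : ℕ) (a : V →₀ ℕ) : Submodule k (F.ι n → k) :=
  F.resCycles n ⊓ residuePart k (F.deg n) a

lemma tensorD_constTensor (n : ℕ) (x : F.ι (n + 1) → k) :
    F.tensorD n (constTensor V k _ x) = constTensor V k _ (F.resD n x) := by
  rw [resD, residueMap_apply, constTensor_residue]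
  rfl

lemma map_resCycles (n : ℕ) :
    (F.resCycles n).map (constTensor V k (F.ι n)) = (F.cycles n).restrictScalars k := by
  ext t
  obtain ⟨x, rfl⟩ := constTensor_surjective t
  rw [Submodule.restrictScalars_mem, ← SetLike.mem_coe, Submodule.map_coe,
    constTensor_injective.mem_set_image, SetLike.mem_coe]
  cases n with
  | zero => exact iff_of_true trivial trivial
  | succ n =>
    change F.resD n x = 0 ↔ F.tensorD n _ = 0
    rw [tensorD_constTensor, map_eq_zero_iff _ constTensor_injective]

lemma map_range_resD (n : ℕ) :
    (LinearMap.range (F.resD n)).map (constTensor V k (F.ι n)) =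
      (F.boundaries n).restrictScalars k := by
  ext t
  constructor
  · rintro ⟨_, ⟨x, rfl⟩, rfl⟩
    exact ⟨_, F.tensorD_constTensor n x⟩
  · rintro ⟨s, rfl⟩
    obtain ⟨x, rfl⟩ := constTensor_surjective s
    exact ⟨_, ⟨x, rfl⟩, (F.tensorD_constTensor n x).symm⟩

lemma map_residuePart (n : ℕ) (a : V →₀ ℕ) :
    (residuePart k (F.deg n) a).map (constTensor V k (F.ι n)) = F.tensorPart n a := by
  apply le_antisymm
  · rintro _ ⟨x, hx, rfl⟩
    refine Submodule.subset_span ⟨a, 0, constVec V k _ x, 1, add_zero a,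
      constVec_mem_freePart hx, ?_, rfl⟩
    exact ⟨1, Submodule.subset_span rfl, rfl⟩
  · classical
    refine Submodule.span_le.2 ?_
    rintro _ ⟨b, c, f, s, rfl, hf, ⟨p, hp, rfl⟩, rfl⟩
    obtain ⟨r, rfl⟩ := Submodule.mem_span_singleton.1 hp
    -- The second factor is moved onto `f`; it has a nonzero constant term only if `c = 0`, and then
    -- the multidegree stays `b`.
    refine ⟨residue V k _ ((r • monomial c (1 : k)) • f), ?_, constTensor_residue_smul _ _⟩
    rw [residue_smul, constantCoeff_smul, constantCoeff_monomial]
    split_ifs with hc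
    · rw [hc, add_zero]
      exact Submodule.smul_mem _ _ (residue_mem_residuePart hf)
    · rw [smul_zero, zero_smul]
      exact zero_mem _

lemma map_resCyclesPart (n : ℕ) (a : V →₀ ℕ) :
    (F.resCyclesPart n a).map (constTensor V k (F.ι n)) =
      (F.cycles n).restrictScalars k ⊓ F.tensorPart n a := by
  rw [resCyclesPart, Submodule.map_inf _ constTensor_injective, map_resCycles, map_residuePart]

lemma multigradedBetti_eq (n : ℕ) (a : V →₀ ℕ) :
    F.multigradedBetti n a =
      Module.finrank k ((F.resCyclesPart n a).map (LinearMap.range (F.resD n)).mkQ) := by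
  -- Both quotient maps, pulled back to coordinates, have the same kernel, so by rank-nullity their
  -- images of the cycles have equal dimension.
  have hker : LinearMap.ker (((F.boundaries n).mkQ.restrictScalars k) ∘ₗ
      constTensor V k (F.ι n)) = LinearMap.ker (LinearMap.range (F.resD n)).mkQ := by
    ext x
    rw [Submodule.ker_mkQ, LinearMap.mem_ker, LinearMap.comp_apply,
      LinearMap.restrictScalars_apply, Submodule.mkQ_apply, Submodule.Quotient.mk_eq_zero,
      ← Submodule.restrictScalars_mem k, ← map_range_resD, ← SetLike.mem_coe, Submodule.map_coe,
      constTensor_injective.mem_set_image, SetLike.mem_coe]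
  have h1 := finrank_map_add_finrank_inf_ker (F.resCyclesPart n a)
    (((F.boundaries n).mkQ.restrictScalars k) ∘ₗ constTensor V k (F.ι n))
  have h2 := finrank_map_add_finrank_inf_ker (F.resCyclesPart n a)
    (LinearMap.range (F.resD n)).mkQ
  rw [hker, Submodule.map_comp, map_resCyclesPart] at h1
  rw [multigradedBetti, torPart]
  omega

end MultigradedFreeResolution

/-! ### Homogeneous lifting through graded free modules. -/

section Lifting

variable {V : Type u} {k : Type v} [Field k] {ι : Type w} {ι' : Type w'} {ι'' : Type w''}

lemma mul_mem_shiftPart {c b a : V →₀ ℕ} {p q : MvPolynomial V k} (hp : p ∈ shiftPart k b a)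
    (hq : q ∈ shiftPart k c b) : p * q ∈ shiftPart k c a := by
  unfold shiftPart at hp hq
  induction hp, hq using Submodule.span_induction₂ with
  | mem_mem x y hx hy =>
    obtain ⟨b, rfl, rfl⟩ := hx
    obtain ⟨b', rfl, rfl⟩ := hy
    rw [monomial_mul, mul_one, add_comm b b', add_assoc]
    exact monomial_mem _ _ _
  | zero_left y _ => simp
  | zero_right x _ => simp
  | add_left x y z _ _ _ hx hy => rw [add_mul]; exact add_mem hx hy
  | add_right x y z _ _ _ hx hy => rw [mul_add]; exact add_mem hx hy
  | smul_left r x y _ _ h => rw [smul_mul_assoc]; exact Submodule.smul_mem _ _ h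
  | smul_right r x y _ _ h => rw [mul_smul_comm]; exact Submodule.smul_mem _ _ h

lemma isHomogeneousMap_linearCombination [Fintype ι] {deg : ι → V →₀ ℕ} {deg' : ι' → V →₀ ℕ}
    {g : ι → ι' → MvPolynomial V k} (hg : ∀ j, g j ∈ freePart k deg' (deg j)) :
    IsHomogeneousMap deg deg' (Fintype.linearCombination (MvPolynomial V k) g) := by
  intro a f hf
  rw [Fintype.linearCombination_apply]
  exact Submodule.sum_mem _ fun j _ i _ => mul_mem_shiftPart (hf j trivial) (hg j i trivial)

namespace IsHomogeneousMap

variable {deg : ι → V →₀ ℕ} {deg' : ι' → V →₀ ℕ} {deg'' : ι'' → V →₀ ℕ}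

lemma id : IsHomogeneousMap (k := k) deg deg LinearMap.id := fun _ _ h => h

lemma comp {φ : (ι' → MvPolynomial V k) →ₗ[MvPolynomial V k] (ι'' → MvPolynomial V k)}
    {ψ : (ι → MvPolynomial V k) →ₗ[MvPolynomial V k] (ι' → MvPolynomial V k)}
    (hφ : IsHomogeneousMap deg' deg'' φ) (hψ : IsHomogeneousMap deg deg' ψ) :
    IsHomogeneousMap deg deg'' (φ ∘ₗ ψ) :=
  fun a f hf => hφ a _ (hψ a f hf)

lemma sub {φ ψ : (ι → MvPolynomial V k) →ₗ[MvPolynomial V k] (ι' → MvPolynomial V k)}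
    (hφ : IsHomogeneousMap deg deg' φ) (hψ : IsHomogeneousMap deg deg' ψ) :
    IsHomogeneousMap deg deg' (φ - ψ) :=
  fun a f hf => sub_mem (hφ a f hf) (hψ a f hf)

end IsHomogeneousMap

lemma single_mem_freePart [DecidableEq ι] (deg : ι → V →₀ ℕ) (j : ι) :
    Pi.single j 1 ∈ freePart k deg (deg j) := by
  intro i _
  by_cases h : i = j
  · subst h
    simpa using monomial_mem (k := k) (deg i) 0 1
  · rw [Pi.single_eq_of_ne h]
    exact zero_mem _

section

variable {N : Type*} [AddCommGroup N] [Module (MvPolynomial V k) N] [Module k N]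

/-- A homogeneous element in the image of a homogeneous map has a homogeneous preimage. -/
lemma map_comp_eq_of_mem [Finite ι] {deg : ι → V →₀ ℕ} {P : (V →₀ ℕ) → Submodule k N}
    (π : (V →₀ ℕ) → N →ₗ[k] N) (hπ : ∀ a, ∀ y ∈ P a, π a y = y)
    (hπ' : ∀ a b, ∀ y ∈ P b, b ≠ a → π a y = 0)
    {q : (ι → MvPolynomial V k) →ₗ[MvPolynomial V k] N}
    (hq : ∀ a, ∀ f ∈ freePart k deg a, q f ∈ P a) {a : V →₀ ℕ} {f : ι → MvPolynomial V k}
    (hf : q f ∈ P a) : q (comp k deg a f) = q f := by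
  classical
  obtain ⟨s, hs⟩ := sum_comp deg f
  rw [← hπ a _ hf]
  conv_rhs => rw [← hs (insert a s) (Finset.subset_insert a s), map_sum, map_sum]
  rw [Finset.sum_eq_single a]
  · rw [hπ a _ (hq a _ (comp_mem deg a f))]
  · intro b _ hb
    exact hπ' a b _ (hq b _ (comp_mem deg b f)) hb
  · intro h
    exact absurd (Finset.mem_insert_self a s) h

/-- Graded free modules are projective. -/
lemma exists_homogeneous_lift [Finite ι] {deg : ι → V →₀ ℕ} {deg' : ι' → V →₀ ℕ}
    {P : (V →₀ ℕ) → Submodule k N} {q : (ι' → MvPolynomial V k) →ₗ[MvPolynomial V k] N}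
    (hq : ∀ a f, q f ∈ P a → q (comp k deg' a f) = q f)
    {φ : (ι → MvPolynomial V k) →ₗ[MvPolynomial V k] N}
    (hφ : ∀ a, ∀ f ∈ freePart k deg a, φ f ∈ P a) (hr : ∀ f, φ f ∈ LinearMap.range q) :
    ∃ ψ, IsHomogeneousMap deg deg' ψ ∧ q ∘ₗ ψ = φ := by
  classical
  cases nonempty_fintype ι
  choose g hg using fun j => hr (Pi.single j 1)
  -- An arbitrary preimage of the image of each basis element is replaced by its component of the
  -- correct multidegree, which makes the lift homogeneous.
  refine ⟨Fintype.linearCombination (MvPolynomial V k) fun j => comp k deg' (deg j) (g j),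
    isHomogeneousMap_linearCombination fun j => comp_mem _ _ _, ?_⟩
  refine LinearMap.pi_ext' fun j => LinearMap.ext_ring ?_
  have hj : q (g j) ∈ P (deg j) := by
    rw [hg]
    exact hφ _ _ (single_mem_freePart deg j)
  rw [LinearMap.comp_apply, LinearMap.comp_apply, LinearMap.comp_apply, LinearMap.single_apply,
    Fintype.linearCombination_apply_single, one_smul, hq _ _ hj, hg]

end

lemma IsHomogeneousMap.map_comp_eq [Finite ι] {deg : ι → V →₀ ℕ} {deg' : ι' → V →₀ ℕ}
    {q : (ι → MvPolynomial V k) →ₗ[MvPolynomial V k] (ι' → MvPolynomial V k)}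
    (hq : IsHomogeneousMap deg deg' q) (a : V →₀ ℕ) (f : ι → MvPolynomial V k)
    (hf : q f ∈ freePart k deg' a) : q (GraphBetti.comp k deg a f) = q f := by
  classical
  refine map_comp_eq_of_mem (GraphBetti.comp k deg') (fun a y hy => ?_) (fun a b y hy h => ?_)
    hq hf
  · rw [comp_of_mem _ _ _ _ hy, if_pos rfl]
  · rw [comp_of_mem _ _ _ _ hy, if_neg h]

/-- The projection of the quotient by a homogeneous ideal to its component of multidegree `a`. -/
def quotComp (I : Ideal (MvPolynomial V k)) (hI : ∀ f ∈ I, ∀ a, monomial a (coeff a f) ∈ I)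
    (a : V →₀ ℕ) : (MvPolynomial V k ⧸ I) →ₗ[k] (MvPolynomial V k ⧸ I) :=
  Submodule.liftQ (I.restrictScalars k)
    ((Ideal.Quotient.mkₐ k I).toLinearMap ∘ₗ (monomial a : k →ₗ[k] _) ∘ₗ lcoeff k a)
    fun f hf => Ideal.Quotient.eq_zero_iff_mem.2 (hI f hf a)

lemma quotComp_of_mem {I : Ideal (MvPolynomial V k)}
    (hI : ∀ f ∈ I, ∀ a, monomial a (coeff a f) ∈ I) (a b : V →₀ ℕ) {y : MvPolynomial V k ⧸ I}
    (hy : y ∈ quotPart I b) [Decidable (b = a)] :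
    quotComp I hI a y = if b = a then y else 0 := by
  classical
  obtain ⟨p, hp, rfl⟩ := hy
  obtain ⟨r, rfl⟩ := Submodule.mem_span_singleton.1 hp
  change Ideal.Quotient.mk I (monomial a (coeff a (r • monomial b (1 : k)))) = _
  rw [coeff_smul, coeff_monomial]
  split_ifs with h
  · subst h
    rw [smul_monomial]
    rfl
  · simp

end Lifting

/-- Dependent choice with an invariant `P` that makes the next choice possible; chain maps and
homotopies are both built this way. -/
lemma exists_seq_of_step {α : ℕ → Type*} {P : ∀ n, α n → Prop} {Q : ∀ n, α n → α (n + 1) → Prop}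
    {x : α 0} (h0 : P 0 x) (hs : ∀ n x, P n x → ∃ y, P (n + 1) y ∧ Q n x y) :
    ∃ s : ∀ n, α n, s 0 = x ∧ ∀ n, P n (s n) ∧ Q n (s n) (s (n + 1)) := by
  choose g hg using hs
  let s : ∀ n, {y : α n // P n y} := fun n =>
    Nat.rec ⟨x, h0⟩ (fun n y => ⟨g n y.1 y.2, (hg n y.1 y.2).1⟩) n
  exact ⟨fun n => (s n).1, rfl, fun n => ⟨(s n).2, (hg n (s n).1 (s n).2).2⟩⟩

/-! ### The comparison theorem: independence of the resolution. -/

namespace MultigradedFreeResolution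

variable {V : Type u} {k : Type v} [Field k] {I : Ideal (MvPolynomial V k)}
  (F : MultigradedFreeResolution.{u, v, w} I) (T : MultigradedFreeResolution.{u, v, w'} I)

lemma aug_comp_eq (hI : ∀ f ∈ I, ∀ a, monomial a (coeff a f) ∈ I) (a : V →₀ ℕ)
    (f : F.ι 0 → MvPolynomial V k) (hf : F.aug f ∈ quotPart I a) :
    F.aug (comp k (F.deg 0) a f) = F.aug f := by
  classical
  refine map_comp_eq_of_mem (quotComp I hI) (fun a y hy => ?_) (fun a b y hy h => ?_)
    F.aug_homogeneous hf
  · rw [quotComp_of_mem hI _ _ hy, if_pos rfl]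
  · rw [quotComp_of_mem hI _ _ hy, if_neg h]

lemma aug_d (f : F.ι 1 → MvPolynomial V k) : F.aug (F.d 0 f) = 0 :=
  F.exact_zero.apply_apply_eq_zero f

lemma d_d (n : ℕ) (f : F.ι (n + 2) → MvPolynomial V k) : F.d n (F.d (n + 1) f) = 0 :=
  (F.exact_succ n).apply_apply_eq_zero f

lemma exists_chainMap (hI : ∀ f ∈ I, ∀ a, monomial a (coeff a f) ∈ I) :
    ∃ φ : ∀ n, (F.ι n → MvPolynomial V k) →ₗ[MvPolynomial V k] (T.ι n → MvPolynomial V k),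
      (∀ n, IsHomogeneousMap (F.deg n) (T.deg n) (φ n)) ∧ T.aug ∘ₗ φ 0 = F.aug ∧
        ∀ n, T.d n ∘ₗ φ (n + 1) = φ n ∘ₗ F.d n := by
  obtain ⟨φ₀, h₀, h₀'⟩ := exists_homogeneous_lift (T.aug_comp_eq hI) F.aug_homogeneous
    fun f => T.aug_surjective (F.aug f)
  have key := exists_seq_of_step
    (α := fun n => (F.ι n → MvPolynomial V k) →ₗ[MvPolynomial V k] (T.ι n → MvPolynomial V k))
    -- The range condition is what allows the next lift; exactness of `T` restores it after each
    -- step.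
    (P := fun n φ => IsHomogeneousMap (F.deg n) (T.deg n) φ ∧
      ∀ f, φ (F.d n f) ∈ LinearMap.range (T.d n))
    (Q := fun n φ ψ => T.d n ∘ₗ ψ = φ ∘ₗ F.d n) (x := φ₀) ⟨h₀, fun f => ?_⟩ fun n φ hφ => ?_
  · obtain ⟨φ, rfl, hφ⟩ := key
    exact ⟨φ, fun n => (hφ n).1.1, h₀', fun n => (hφ n).2⟩
  · rw [LinearMap.mem_range]
    refine (T.exact_zero _).1 ?_
    rw [← LinearMap.comp_apply, h₀', aug_d]
  · obtain ⟨ψ, hψ, hψ'⟩ := exists_homogeneous_lift (φ := φ ∘ₗ F.d n)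
      (IsHomogeneousMap.map_comp_eq (T.d_homogeneous n)) (hφ.1.comp (F.d_homogeneous n)) hφ.2
    refine ⟨ψ, ⟨hψ, fun f => (T.exact_succ n _).1 ?_⟩, hψ'⟩
    rw [← LinearMap.comp_apply, hψ', LinearMap.comp_apply, d_d, map_zero]

/-- A homogeneous chain endomorphism that covers zero on `R / I` is null-homotopic; it is applied to
the identity minus a round trip between two resolutions. -/
lemma exists_homotopy
    {φ : ∀ n, (F.ι n → MvPolynomial V k) →ₗ[MvPolynomial V k] (F.ι n → MvPolynomial V k)}
    (hφ : ∀ n, IsHomogeneousMap (F.deg n) (F.deg n) (φ n)) (haug : F.aug ∘ₗ φ 0 = 0)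
    (hd : ∀ n, F.d n ∘ₗ φ (n + 1) = φ n ∘ₗ F.d n) :
    ∃ h : ∀ n, (F.ι n → MvPolynomial V k) →ₗ[MvPolynomial V k] (F.ι (n + 1) → MvPolynomial V k),
      (∀ n, IsHomogeneousMap (F.deg n) (F.deg (n + 1)) (h n)) ∧ F.d 0 ∘ₗ h 0 = φ 0 ∧
        ∀ n, F.d (n + 1) ∘ₗ h (n + 1) = φ (n + 1) - h n ∘ₗ F.d n := by
  obtain ⟨h₀, hh₀, hh₀'⟩ := exists_homogeneous_lift
    (IsHomogeneousMap.map_comp_eq (F.d_homogeneous 0)) (hφ 0)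
    fun f => (F.exact_zero _).1 (LinearMap.congr_fun haug f)
  have key := exists_seq_of_step
    (α := fun n => (F.ι n → MvPolynomial V k) →ₗ[MvPolynomial V k] (F.ι (n + 1) → MvPolynomial V k))
    (P := fun n h => IsHomogeneousMap (F.deg n) (F.deg (n + 1)) h ∧
      ∀ f, (φ (n + 1) - h ∘ₗ F.d n) f ∈ LinearMap.range (F.d (n + 1)))
    (Q := fun n h h' => F.d (n + 1) ∘ₗ h' = φ (n + 1) - h ∘ₗ F.d n)
    (x := h₀) ⟨hh₀, fun f => (F.exact_succ 0 _).1 ?_⟩ fun n h hh => ?_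
  · obtain ⟨h, rfl, hh⟩ := key
    exact ⟨h, fun n => (hh n).1.1, hh₀', fun n => (hh n).2⟩
  · have h1 := LinearMap.congr_fun hh₀' (F.d 0 f)
    have h2 := LinearMap.congr_fun (hd 0) f
    simp only [LinearMap.comp_apply, LinearMap.sub_apply, map_sub] at h1 h2 ⊢
    rw [h1, h2, sub_self]
  · obtain ⟨ψ, hψ, hψ'⟩ := exists_homogeneous_lift
      (IsHomogeneousMap.map_comp_eq (F.d_homogeneous (n + 1)))
      ((hφ (n + 1)).sub (hh.1.comp (F.d_homogeneous n))) hh.2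
    refine ⟨ψ, ⟨hψ, fun f => (F.exact_succ (n + 1) _).1 ?_⟩, hψ'⟩
    have h1 := LinearMap.congr_fun hψ' (F.d (n + 1) f)
    have h2 := LinearMap.congr_fun (hd (n + 1)) f
    simp only [LinearMap.comp_apply, LinearMap.sub_apply, map_sub, d_d, map_zero, sub_zero]
      at h1 h2 ⊢
    rw [h1, h2, sub_self]

/-- Since `ψ ∘ φ` is homotopic to the identity, `φ` is injective on homology in each multidegree.
Exchanging the resolutions gives the reverse inequality. -/
lemma multigradedBetti_le (hI : ∀ f ∈ I, ∀ a, monomial a (coeff a f) ∈ I) (n : ℕ)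
    (a : V →₀ ℕ) : F.multigradedBetti n a ≤ T.multigradedBetti n a := by
  obtain ⟨φ, hφ, hφaug, hφd⟩ := F.exists_chainMap T hI
  obtain ⟨ψ, hψ, hψaug, hψd⟩ := T.exists_chainMap F hI
  obtain ⟨h, -, hh0, hh⟩ := F.exists_homotopy (φ := fun n => LinearMap.id - ψ n ∘ₗ φ n)
    (fun n => IsHomogeneousMap.id.sub ((hψ n).comp (hφ n)))
    (by rw [LinearMap.comp_sub, ← LinearMap.comp_assoc, hψaug, hφaug, LinearMap.comp_id, sub_self])
    (fun n => by
      rw [LinearMap.comp_sub, ← LinearMap.comp_assoc, hψd, LinearMap.comp_assoc, hφd,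
        LinearMap.sub_comp, LinearMap.comp_id, LinearMap.id_comp, LinearMap.comp_assoc])
  have hφd' : ∀ n, T.resD n ∘ₗ residueMap (φ (n + 1)) = residueMap (φ n) ∘ₗ F.resD n := by
    intro n
    rw [resD, resD, ← residueMap_comp, ← residueMap_comp, hφd]
  have hψd' : ∀ n, F.resD n ∘ₗ residueMap (ψ (n + 1)) = residueMap (ψ n) ∘ₗ T.resD n := by
    intro n
    rw [resD, resD, ← residueMap_comp, ← residueMap_comp, hψd]
  have hmem : ∀ x ∈ F.resCyclesPart n a, residueMap (φ n) x ∈ T.resCyclesPart n a := by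
    intro x hx
    refine ⟨?_, (hφ n).residueMap_mem hx.2⟩
    cases n with
    | zero => trivial
    | succ n =>
      have h1 := LinearMap.congr_fun (hφd' n) x
      rw [LinearMap.comp_apply, LinearMap.comp_apply, LinearMap.mem_ker.1 hx.1, map_zero] at h1
      exact h1
  have hhomotopy : ∀ x ∈ F.resCyclesPart n a,
      F.resD n (residueMap (h n) x) = x - residueMap (ψ n) (residueMap (φ n) x) := by
    intro x hx
    rw [resD, ← LinearMap.comp_apply, ← residueMap_comp]
    cases n with
    | zero => rw [hh0, residueMap_sub, residueMap_id, residueMap_comp]; rfl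
    | succ n =>
      rw [hh, residueMap_sub, residueMap_sub, residueMap_id, residueMap_comp, residueMap_comp]
      have h1 : residueMap (F.d n) x = 0 := hx.1
      simp [h1]
  rw [multigradedBetti_eq, multigradedBetti_eq]
  have h1 := finrank_map_add_finrank_inf_ker (F.resCyclesPart n a)
    ((LinearMap.range (T.resD n)).mkQ ∘ₗ residueMap (φ n))
  have h2 := finrank_map_add_finrank_inf_ker (F.resCyclesPart n a)
    (LinearMap.range (F.resD n)).mkQ
  have h3 : Module.finrank k ((F.resCyclesPart n a).map
      ((LinearMap.range (T.resD n)).mkQ ∘ₗ residueMap (φ n))) ≤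
      Module.finrank k ((T.resCyclesPart n a).map (LinearMap.range (T.resD n)).mkQ) := by
    refine Submodule.finrank_mono ?_
    rw [Submodule.map_comp]
    refine Submodule.map_mono ?_
    rintro _ ⟨x, hx, rfl⟩
    exact hmem x hx
  -- If `φ x = ∂ y`, then `x = ψ (φ x) + ∂ (h x) = ∂ (ψ y + h x)` is a boundary.
  have h4 : Module.finrank k ↥(F.resCyclesPart n a ⊓
      LinearMap.ker ((LinearMap.range (T.resD n)).mkQ ∘ₗ residueMap (φ n))) ≤
      Module.finrank k ↥(F.resCyclesPart n a ⊓
        LinearMap.ker (LinearMap.range (F.resD n)).mkQ) := by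
    refine Submodule.finrank_mono fun x hx => ⟨hx.1, ?_⟩
    have hx2 := hx.2
    rw [SetLike.mem_coe, LinearMap.mem_ker, LinearMap.comp_apply, Submodule.mkQ_apply,
      Submodule.Quotient.mk_eq_zero] at hx2
    obtain ⟨y, hy⟩ := hx2
    rw [SetLike.mem_coe, Submodule.ker_mkQ]
    have h5 := hhomotopy x hx.1
    have h6 := LinearMap.congr_fun (hψd' n) y
    rw [LinearMap.comp_apply, LinearMap.comp_apply, hy] at h6
    rw [← h6, eq_sub_iff_add_eq, ← map_add] at h5
    exact ⟨_, h5⟩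
  omega

/-- Multigraded Betti numbers do not depend on the resolution. -/
theorem multigradedBetti_eq_of_resolution (hI : ∀ f ∈ I, ∀ a, monomial a (coeff a f) ∈ I) (n : ℕ)
    (a : V →₀ ℕ) : F.multigradedBetti n a = T.multigradedBetti n a :=
  le_antisymm (F.multigradedBetti_le T hI n a) (T.multigradedBetti_le F hI n a)

end MultigradedFreeResolution

/-! ### The Taylor resolution of a monomial ideal. -/

section Taylor

variable {V : Type u} (k : Type v) [Field k] {r : ℕ} (m : Fin r → V →₀ ℕ)

/-- The exponent of the least common multiple of a set of monomials. -/
def lcmExp (σ : Finset (Fin r)) : V →₀ ℕ := σ.sup m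

lemma lcmExp_mono {σ τ : Finset (Fin r)} (h : σ ⊆ τ) : lcmExp m σ ≤ lcmExp m τ :=
  Finset.sup_mono h

lemma le_lcmExp {σ : Finset (Fin r)} {e : Fin r} (h : e ∈ σ) : m e ≤ lcmExp m σ :=
  Finset.le_sup h

lemma lcmExp_insert_le {σ : Finset (Fin r)} {e : Fin r} {a : V →₀ ℕ} (he : m e ≤ a)
    (hσ : lcmExp m σ ≤ a) : lcmExp m (insert e σ) ≤ a := by
  rw [lcmExp, Finset.sup_insert]
  exact sup_le he hσ

/-- The sign of the face of `σ` opposite to `e`. -/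
def faceSign (σ : Finset (Fin r)) (e : Fin r) : k := (-1) ^ (σ.filter (· < e)).card

lemma faceSign_ne_zero (σ : Finset (Fin r)) (e : Fin r) : faceSign k σ e ≠ 0 :=
  pow_ne_zero _ (neg_ne_zero.2 one_ne_zero)

variable {k}

lemma faceSign_of_le {σ : Finset (Fin r)} {e : Fin r} (h : ∀ f ∈ σ, e ≤ f) :
    faceSign k σ e = 1 := by
  rw [faceSign, Finset.filter_false_of_mem fun f hf => not_lt.2 (h f hf), Finset.card_empty,
    pow_zero]

lemma faceSign_insert {σ : Finset (Fin r)} {e f : Fin r} (he : e ∉ σ) (h : e < f) :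
    faceSign k (insert e σ) f = -faceSign k σ f := by
  rw [faceSign, faceSign, Finset.filter_insert, if_pos h,
    Finset.card_insert_of_notMem fun h' => he (Finset.mem_filter.1 h').1, pow_succ, mul_neg_one]

lemma faceSign_erase_of_lt {σ : Finset (Fin r)} {e f : Fin r} (he : e ∈ σ) (h : e < f) :
    faceSign k (σ.erase e) f = -faceSign k σ f := by
  conv_rhs => rw [← Finset.insert_erase he, faceSign_insert (Finset.notMem_erase e σ) h, neg_neg]

lemma faceSign_erase_of_le {σ : Finset (Fin r)} {e f : Fin r} (h : f ≤ e) :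
    faceSign k (σ.erase e) f = faceSign k σ f := by
  rw [faceSign, faceSign, Finset.filter_erase, Finset.erase_eq_of_notMem]
  exact fun h' => not_lt.2 h (Finset.mem_filter.1 h').2

/-- Removing the smaller of two vertices lowers the position of the larger by one, while removing
the larger leaves the smaller in place. This sign makes the square of the differential vanish. -/
lemma faceSign_mul_faceSign_erase {σ : Finset (Fin r)} {e f : Fin r} (he : e ∈ σ) (hf : f ∈ σ)
    (h : e ≠ f) : faceSign k σ e * faceSign k (σ.erase e) f =
      -(faceSign k σ f * faceSign k (σ.erase f) e) := by
  rcases lt_or_gt_of_ne h with h | h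
  · rw [faceSign_erase_of_lt he h, faceSign_erase_of_le h.le]
    ring
  · rw [faceSign_erase_of_lt hf h, faceSign_erase_of_le h.le]
    ring

variable (k)

/-- The multiple of multidegree `a` of the basis element `e_σ`. -/
def taylorBasis (σ : Finset (Fin r)) (a : V →₀ ℕ) : Finset (Fin r) → MvPolynomial V k :=
  Pi.single σ (monomial (a - lcmExp m σ) 1)

/-- The image of the basis element `e_σ` under the Taylor differential. -/
def taylorFaces (σ : Finset (Fin r)) : Finset (Fin r) → MvPolynomial V k :=
  ∑ e ∈ σ, faceSign k σ e • taylorBasis k m (σ.erase e) (lcmExp m σ)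

/-- The differential of the Taylor complex, all homological degrees at once. -/
def taylorD : (Finset (Fin r) → MvPolynomial V k) →ₗ[MvPolynomial V k]
    (Finset (Fin r) → MvPolynomial V k) :=
  Fintype.linearCombination (MvPolynomial V k) (taylorFaces k m)

open Classical in
/-- The contraction on multiples of the basis elements: add the first monomial dividing `x^a`. -/
def taylorCone (σ : Finset (Fin r)) (a : V →₀ ℕ) : Finset (Fin r) → MvPolynomial V k :=
  if h : (Finset.univ.filter fun e => m e ≤ a).Nonempty then
    if (Finset.univ.filter fun e => m e ≤ a).min' h ∈ σ then 0
    else taylorBasis k m (insert ((Finset.univ.filter fun e => m e ≤ a).min' h) σ) a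
  else 0

/-- The contracting homotopy of the Taylor complex. -/
def taylorH : (Finset (Fin r) → MvPolynomial V k) →ₗ[k] (Finset (Fin r) → MvPolynomial V k) :=
  ∑ σ, (basisMonomials V k).constr k (fun b => taylorCone k m σ (b + lcmExp m σ)) ∘ₗ
    LinearMap.proj σ

lemma monomial_smul_taylorBasis {σ : Finset (Fin r)} {a : V →₀ ℕ} (b : V →₀ ℕ)
    (h : lcmExp m σ ≤ a) :
    (monomial b (1 : k)) • taylorBasis k m σ a = taylorBasis k m σ (b + a) := by
  rw [taylorBasis, ← Pi.single_smul, smul_eq_mul, monomial_mul, one_mul, taylorBasis,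
    add_tsub_assoc_of_le h]

lemma taylorD_single (σ : Finset (Fin r)) (p : MvPolynomial V k) :
    taylorD k m (Pi.single σ p) = p • taylorFaces k m σ := by
  rw [taylorD, Fintype.linearCombination_apply_single]

lemma taylorD_basis {σ : Finset (Fin r)} {a : V →₀ ℕ} (h : lcmExp m σ ≤ a) :
    taylorD k m (taylorBasis k m σ a) =
      ∑ e ∈ σ, faceSign k σ e • taylorBasis k m (σ.erase e) a := by
  rw [taylorBasis, taylorD_single, taylorFaces, Finset.smul_sum]
  refine Finset.sum_congr rfl fun e _ => ?_
  rw [smul_comm, monomial_smul_taylorBasis _ _ _ (lcmExp_mono m (Finset.erase_subset e σ)),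
    tsub_add_cancel_of_le h]

lemma taylorH_basis {σ : Finset (Fin r)} {a : V →₀ ℕ} (h : lcmExp m σ ≤ a) :
    taylorH k m (taylorBasis k m σ a) = taylorCone k m σ a := by
  classical
  rw [taylorH, LinearMap.sum_apply, Finset.sum_eq_single σ]
  · rw [LinearMap.comp_apply, LinearMap.proj_apply, taylorBasis, Pi.single_eq_same,
      show monomial (a - lcmExp m σ) (1 : k) = basisMonomials V k (a - lcmExp m σ) by
        rw [coe_basisMonomials],
      Module.Basis.constr_basis, tsub_add_cancel_of_le h]
  · intro τ _ hτ
    rw [LinearMap.comp_apply, LinearMap.proj_apply, taylorBasis, Pi.single_eq_of_ne hτ, map_zero]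
  · simp

lemma taylorCone_of_mem {σ : Finset (Fin r)} {a : V →₀ ℕ} {e : Fin r} (he : m e ≤ a)
    (hmin : ∀ f, m f ≤ a → e ≤ f) (h : e ∈ σ) : taylorCone k m σ a = 0 := by
  classical
  have hne : (Finset.univ.filter fun e => m e ≤ a).Nonempty := ⟨e, by simpa using he⟩
  have : (Finset.univ.filter fun e => m e ≤ a).min' hne = e :=
    le_antisymm (Finset.min'_le _ _ (by simpa using he)) (Finset.le_min' _ _ _ (by simpa using hmin))
  rw [taylorCone, dif_pos hne, this, if_pos h]

lemma taylorCone_of_notMem {σ : Finset (Fin r)} {a : V →₀ ℕ} {e : Fin r} (he : m e ≤ a)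
    (hmin : ∀ f, m f ≤ a → e ≤ f) (h : e ∉ σ) :
    taylorCone k m σ a = taylorBasis k m (insert e σ) a := by
  classical
  have hne : (Finset.univ.filter fun e => m e ≤ a).Nonempty := ⟨e, by simpa using he⟩
  have : (Finset.univ.filter fun e => m e ≤ a).min' hne = e :=
    le_antisymm (Finset.min'_le _ _ (by simpa using he)) (Finset.le_min' _ _ _ (by simpa using hmin))
  rw [taylorCone, dif_pos hne, this, if_neg h]

/-- In multidegree `a` the Taylor complex is the augmented chain complex of the full simplex on the
generators dividing `x^a`. It is contracted by coning from the smallest vertex `e`, a choice for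
which the sign of adding `e` is always `1`. -/
lemma taylor_homotopy_basis {σ : Finset (Fin r)} {a : V →₀ ℕ} {e : Fin r} (he : m e ≤ a)
    (hmin : ∀ f, m f ≤ a → e ≤ f) (h : lcmExp m σ ≤ a) :
    taylorD k m (taylorH k m (taylorBasis k m σ a)) +
      taylorH k m (taylorD k m (taylorBasis k m σ a)) = taylorBasis k m σ a := by
  have hlt : ∀ f ∈ σ, e ≤ f := fun f hf => hmin f ((le_lcmExp m hf).trans h)
  have hH : ∀ f, taylorH k m (taylorBasis k m (σ.erase f) a) = taylorCone k m (σ.erase f) a :=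
    fun f => taylorH_basis k m ((lcmExp_mono m (Finset.erase_subset f σ)).trans h)
  rw [taylorH_basis k m h, taylorD_basis k m h, map_sum]
  simp only [map_smul, hH]
  -- If `e ∈ σ`, only the face opposite `e` survives coning, and it returns `σ`. Otherwise the
  -- boundary of the cone is `σ` minus the coned faces of `σ`, which the second term restores.
  by_cases heσ : e ∈ σ
  · rw [taylorCone_of_mem k m he hmin heσ, map_zero, zero_add, Finset.sum_eq_single e]
    · rw [faceSign_of_le hlt, one_smul,
        taylorCone_of_notMem k m he hmin (Finset.notMem_erase e σ), Finset.insert_erase heσ]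
    · intro f _ hf
      rw [taylorCone_of_mem k m he hmin (Finset.mem_erase.2 ⟨hf.symm, heσ⟩), smul_zero]
    · exact fun h' => absurd heσ h'
  · rw [taylorCone_of_notMem k m he hmin heσ, taylorD_basis k m (lcmExp_insert_le m he h),
      Finset.sum_insert heσ, Finset.erase_insert heσ, faceSign_of_le (by simpa using hlt),
      one_smul, add_assoc, ← Finset.sum_add_distrib, Finset.sum_eq_zero, add_zero]
    intro f hf
    have hne : e ≠ f := fun h' => heσ (h' ▸ hf)
    rw [faceSign_insert heσ (lt_of_le_of_ne (hlt f hf) hne),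
      taylorCone_of_notMem k m he hmin fun h' => heσ (Finset.mem_of_mem_erase h'),
      Finset.erase_insert_of_ne hne, neg_smul, neg_add_cancel]

lemma taylorD_taylorD_basis {σ : Finset (Fin r)} {a : V →₀ ℕ} (h : lcmExp m σ ≤ a) :
    taylorD k m (taylorD k m (taylorBasis k m σ a)) = 0 := by
  have hD : ∀ f, taylorD k m (taylorBasis k m (σ.erase f) a) = _ :=
    fun f => taylorD_basis k m ((lcmExp_mono m (Finset.erase_subset f σ)).trans h)
  rw [taylorD_basis k m h, map_sum]
  simp only [LinearMap.map_smul_of_tower, hD, Finset.smul_sum, smul_smul]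
  rw [Finset.sum_sigma']
  -- The terms cancel in pairs according to the order in which two vertices are removed.
  refine Finset.sum_involution (fun x _ => ⟨x.2, x.1⟩) ?_ ?_ ?_ ?_
  · rintro ⟨e, f⟩ hx
    simp only [Finset.mem_sigma, Finset.mem_erase] at hx
    rw [faceSign_mul_faceSign_erase hx.1 hx.2.2 hx.2.1.symm, neg_smul, Finset.erase_right_comm,
      neg_add_cancel]
  · rintro ⟨e, f⟩ hx _ h'
    simp only [Finset.mem_sigma, Finset.mem_erase] at hx
    simp only [Sigma.mk.injEq] at h'
    exact hx.2.1 h'.1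
  · rintro ⟨e, f⟩ hx
    simp only [Finset.mem_sigma, Finset.mem_erase] at hx ⊢
    exact ⟨hx.2.2, hx.2.1.symm, hx.1⟩
  · rintro ⟨e, f⟩ hx
    rfl

variable {k m}

/-- The monomial multiples of the `e_σ` span over `k`. Linearity over `k` is all that can be used,
because the apex of the cone, and hence `taylorH`, depends on the multidegree. -/
lemma taylor_induction {motive : (Finset (Fin r) → MvPolynomial V k) → Prop} {s : Set (Finset (Fin r))}
    (basis : ∀ σ a, σ ∈ s → lcmExp m σ ≤ a → motive (taylorBasis k m σ a))
    (zero : motive 0) (add : ∀ f g, motive f → motive g → motive (f + g))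
    (smul : ∀ (c : k) f, motive f → motive (c • f))
    (f : Finset (Fin r) → MvPolynomial V k) (hf : ∀ σ, σ ∉ s → f σ = 0) : motive f := by
  classical
  rw [← Finset.univ_sum_single f]
  refine Finset.sum_induction _ motive add zero fun σ _ => ?_
  by_cases hσ : σ ∈ s
  · induction f σ using MvPolynomial.induction_on' with
    | add p q hp hq => rw [Pi.single_add]; exact add _ _ hp hq
    | monomial b c =>
      have : (Pi.single σ (monomial b c) : Finset (Fin r) → MvPolynomial V k) =
          c • taylorBasis k m σ (b + lcmExp m σ) := by
        rw [taylorBasis, add_tsub_cancel_right, ← Pi.single_smul, smul_monomial, smul_eq_mul,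
          mul_one]
      rw [this]
      exact smul _ _ (basis _ _ hσ le_add_self)
  · rw [hf σ hσ, Pi.single_zero]
    exact zero

variable (k m)

lemma taylorD_taylorD (f : Finset (Fin r) → MvPolynomial V k) :
    taylorD k m (taylorD k m f) = 0 := by
  refine taylor_induction (m := m) (s := Set.univ)
    (motive := fun f => taylorD k m (taylorD k m f) = 0) (fun σ a _ h => taylorD_taylorD_basis k m h)
    (by simp) (fun f g hf hg => by simp [hf, hg])
    (fun c f hf => by simp only [LinearMap.map_smul_of_tower, hf, smul_zero]) f
    fun σ h => absurd trivial h

/-- A monomial multiple of `e_σ` with `σ` nonempty is divisible by some generator, so an apex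
exists. At `∅` this can fail, and the failure is the homology `R / I`. -/
lemma taylor_homotopy (f : Finset (Fin r) → MvPolynomial V k) (hf : f ∅ = 0) :
    taylorD k m (taylorH k m f) + taylorH k m (taylorD k m f) = f := by
  classical
  refine taylor_induction (m := m) (s := {σ | σ.Nonempty})
    (motive := fun f => taylorD k m (taylorH k m f) + taylorH k m (taylorD k m f) = f)
    (fun σ a hσ h => ?_)
    (by simp) (fun f g hf hg => ?_) (fun c f hf => ?_) f fun σ h => ?_
  · obtain ⟨e, he⟩ := hσ
    have hne : (Finset.univ.filter fun e => m e ≤ a).Nonempty :=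
      ⟨e, by simpa using (le_lcmExp m he).trans h⟩
    exact taylor_homotopy_basis k m (by simpa using Finset.min'_mem _ hne)
      (fun f hf => Finset.min'_le _ f (Finset.mem_filter.2 ⟨Finset.mem_univ f, hf⟩)) h
  · simp only [map_add]
    rw [add_add_add_comm, hf, hg]
  · simp only [LinearMap.map_smul_of_tower, map_smul]
    rw [← smul_add, hf]
  · rw [Set.mem_ofPred_eq, Finset.not_nonempty_iff_eq_empty] at h
    rw [h, hf]

lemma taylorD_apply_eq_zero {n : ℕ} (f : Finset (Fin r) → MvPolynomial V k)
    (hf : ∀ σ, σ.card ≠ n + 1 → f σ = 0) (σ : Finset (Fin r)) (hσ : σ.card ≠ n) :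
    taylorD k m f σ = 0 := by
  revert σ
  refine taylor_induction (m := m) (s := {σ | σ.card = n + 1})
    (motive := fun f => ∀ σ : Finset (Fin r), σ.card ≠ n → taylorD k m f σ = 0)
    (fun τ a hτ h => ?_)
    (by simp) (fun f g hf hg σ hσ => ?_) (fun c f hf σ hσ => ?_) f hf
  · intro σ hσ
    rw [taylorD_basis k m h, Finset.sum_apply]
    refine Finset.sum_eq_zero fun e he => ?_
    rw [Pi.smul_apply, taylorBasis, Pi.single_eq_of_ne, smul_zero]
    rintro rfl
    rw [Finset.card_erase_of_mem he, show τ.card = n + 1 from hτ] at hσ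
    exact hσ rfl
  · simp [hf σ hσ, hg σ hσ]
  · rw [LinearMap.map_smul_of_tower, Pi.smul_apply, hf σ hσ, smul_zero]

lemma taylorH_apply_eq_zero {n : ℕ} (f : Finset (Fin r) → MvPolynomial V k)
    (hf : ∀ σ, σ.card ≠ n → f σ = 0) (σ : Finset (Fin r)) (hσ : σ.card ≠ n + 1) :
    taylorH k m f σ = 0 := by
  classical
  revert σ
  refine taylor_induction (m := m) (s := {σ | σ.card = n})
    (motive := fun f => ∀ σ : Finset (Fin r), σ.card ≠ n + 1 → taylorH k m f σ = 0)
    (fun τ a hτ h => ?_)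
    (by simp) (fun f g hf hg σ hσ => ?_) (fun c f hf σ hσ => ?_) f hf
  · intro σ hσ
    rw [taylorH_basis k m h, taylorCone]
    split_ifs with h1 h2
    · rfl
    · rw [taylorBasis, Pi.single_eq_of_ne]
      rintro rfl
      rw [Finset.card_insert_of_notMem h2, show τ.card = n from hτ] at hσ
      exact hσ rfl
    · rfl
  · simp [hf σ hσ, hg σ hσ]
  · rw [map_smul, Pi.smul_apply, hf σ hσ, smul_zero]

/-- The sets of `n` of the given monomials. -/
abbrev TaylorIndex (r n : ℕ) : Type := {σ : Finset (Fin r) // σ.card = n}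

variable (V) in
/-- Extension by zero from one homological degree of the Taylor complex. -/
def taylorExtend (n : ℕ) : (TaylorIndex r n → MvPolynomial V k) →ₗ[MvPolynomial V k]
    (Finset (Fin r) → MvPolynomial V k) where
  toFun f σ := if h : σ.card = n then f ⟨σ, h⟩ else 0
  map_add' f g := by
    ext1 σ
    by_cases h : σ.card = n <;> simp [h]
  map_smul' c f := by
    ext1 σ
    by_cases h : σ.card = n <;> simp [h]

variable (V) in
/-- Restriction to one homological degree of the Taylor complex. -/
def taylorRestrict (n : ℕ) : (Finset (Fin r) → MvPolynomial V k) →ₗ[MvPolynomial V k]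
    (TaylorIndex r n → MvPolynomial V k) :=
  LinearMap.funLeft (MvPolynomial V k) (MvPolynomial V k) Subtype.val

@[simp]
lemma taylorRestrict_apply (n : ℕ) (f : Finset (Fin r) → MvPolynomial V k)
    (σ : TaylorIndex r n) : taylorRestrict V k n f σ = f σ := rfl

lemma taylorExtend_apply_of_ne {n : ℕ} (f : TaylorIndex r n → MvPolynomial V k)
    (σ : Finset (Fin r)) (h : σ.card ≠ n) : taylorExtend V k n f σ = 0 := dif_neg h

@[simp]
lemma taylorExtend_apply_val {n : ℕ} (f : TaylorIndex r n → MvPolynomial V k)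
    (σ : TaylorIndex r n) : taylorExtend V k n f σ = f σ := dif_pos σ.2

lemma taylorRestrict_extend {n : ℕ} (f : TaylorIndex r n → MvPolynomial V k) :
    taylorRestrict V k n (taylorExtend V k n f) = f := by
  ext1 σ
  simp

lemma taylorExtend_restrict {n : ℕ} (f : Finset (Fin r) → MvPolynomial V k)
    (hf : ∀ σ, σ.card ≠ n → f σ = 0) : taylorExtend V k n (taylorRestrict V k n f) = f := by
  ext1 σ
  by_cases h : σ.card = n
  · exact dif_pos h
  · rw [taylorExtend_apply_of_ne _ _ _ h, hf σ h]

lemma taylorExtend_single {n : ℕ} (σ : TaylorIndex r n) (p : MvPolynomial V k) :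
    taylorExtend V k n (Pi.single σ p) = Pi.single σ.1 p := by
  ext1 τ
  by_cases h : τ.card = n
  · rw [show τ = (⟨τ, h⟩ : TaylorIndex r n).1 from rfl, taylorExtend_apply_val, Pi.single_apply,
      Pi.single_apply]
    simp only [Subtype.ext_iff]
  · rw [taylorExtend_apply_of_ne _ _ _ h, Pi.single_eq_of_ne]
    rintro rfl
    exact h σ.2

/-- The differential of the Taylor complex. -/
def taylorDiff (n : ℕ) : (TaylorIndex r (n + 1) → MvPolynomial V k) →ₗ[MvPolynomial V k]
    (TaylorIndex r n → MvPolynomial V k) :=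
  taylorRestrict V k n ∘ₗ taylorD k m ∘ₗ taylorExtend V k (n + 1)

lemma taylorExtend_taylorDiff (n : ℕ) (f : TaylorIndex r (n + 1) → MvPolynomial V k) :
    taylorExtend V k n (taylorDiff k m n f) = taylorD k m (taylorExtend V k (n + 1) f) :=
  taylorExtend_restrict k _ fun σ hσ =>
    taylorD_apply_eq_zero k m _ (taylorExtend_apply_of_ne k f) σ hσ

lemma taylorDiff_single (n : ℕ) (σ : TaylorIndex r (n + 1)) (τ : TaylorIndex r n) :
    taylorDiff k m n (Pi.single σ 1) τ = taylorFaces k m σ τ := by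
  rw [taylorDiff, LinearMap.comp_apply, LinearMap.comp_apply, taylorExtend_single,
    taylorD_single, one_smul, taylorRestrict_apply]

lemma taylorBasis_mem {σ : Finset (Fin r)} {a : V →₀ ℕ} (h : lcmExp m σ ≤ a) :
    taylorBasis k m σ a ∈ freePart k (lcmExp m) a := by
  intro τ _
  by_cases hτ : τ = σ
  · subst hτ
    rw [taylorBasis, Pi.single_eq_same]
    conv in shiftPart _ _ _ => rw [← add_tsub_cancel_of_le h]
    exact monomial_mem _ _ _
  · rw [taylorBasis, Pi.single_eq_of_ne hτ]
    exact zero_mem _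

lemma taylorDiff_homogeneous (n : ℕ) :
    IsHomogeneousMap (fun σ : TaylorIndex r (n + 1) => lcmExp m σ.1)
      (fun σ : TaylorIndex r n => lcmExp m σ.1) (taylorDiff k m n) := by
  intro a f hf
  have h1 : IsHomogeneousMap (lcmExp m) (lcmExp m) (taylorD k m) :=
    isHomogeneousMap_linearCombination fun σ => Submodule.sum_mem _ fun e _ =>
      Submodule.smul_mem _ _ (taylorBasis_mem k m (lcmExp_mono m (Finset.erase_subset e σ)))
  have h2 : taylorExtend V k (n + 1) f ∈ freePart k (lcmExp m) a := by
    intro σ _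
    by_cases h : σ.card = n + 1
    · have := hf ⟨σ, h⟩ trivial
      rwa [← taylorExtend_apply_val k f] at this
    · rw [taylorExtend_apply_of_ne _ _ _ h]
      exact zero_mem _
  exact fun σ _ => h1 a _ h2 σ.1 trivial

lemma taylorDiff_exact (n : ℕ) :
    Function.Exact (taylorDiff k m (n + 1)) (taylorDiff k m n) := by
  intro f
  constructor
  · intro hf
    have h1 : taylorD k m (taylorExtend V k (n + 1) f) = 0 := by
      rw [← taylorExtend_taylorDiff, hf, map_zero]
    have h2 := taylor_homotopy k m (taylorExtend V k (n + 1) f)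
      (taylorExtend_apply_of_ne k f ∅ (by simp))
    rw [h1, map_zero, add_zero] at h2
    refine ⟨taylorRestrict V k (n + 2) (taylorH k m (taylorExtend V k (n + 1) f)), ?_⟩
    rw [taylorDiff, LinearMap.comp_apply, LinearMap.comp_apply, taylorExtend_restrict, h2,
      taylorRestrict_extend]
    exact taylorH_apply_eq_zero k m _ (taylorExtend_apply_of_ne k f)
  · rintro ⟨g, rfl⟩
    rw [taylorDiff, LinearMap.comp_apply, LinearMap.comp_apply, taylorExtend_taylorDiff,
      taylorD_taylorD, map_zero]

lemma taylorDiff_zero_single (e : Fin r) :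
    taylorDiff k m 0 (Pi.single ⟨{e}, Finset.card_singleton e⟩ 1) =
      fun _ => monomial (m e) 1 := by
  ext1 ⟨τ, hτ⟩
  obtain rfl := Finset.card_eq_zero.1 hτ
  rw [taylorDiff_single, taylorFaces, Finset.sum_singleton, faceSign_of_le (by simp), one_smul,
    taylorBasis]
  simp [lcmExp, bot_eq_zero]

/-- The ideal generated by the given monomials. -/
def monomialIdeal : Ideal (MvPolynomial V k) :=
  Ideal.span (Set.range fun e => monomial (m e) 1)

/-- The augmentation of the Taylor complex. -/
def taylorAug : (TaylorIndex r 0 → MvPolynomial V k) →ₗ[MvPolynomial V k]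
    (MvPolynomial V k ⧸ monomialIdeal k m) :=
  (Submodule.mkQ (monomialIdeal k m)) ∘ₗ LinearMap.proj ⟨∅, Finset.card_empty⟩

lemma taylorAug_exact : Function.Exact (taylorDiff k m 0) (taylorAug k m) := by
  refine LinearMap.exact_iff.2 (le_antisymm ?_ ?_)
  · intro f hf
    have h1 : monomialIdeal k m ≤ (LinearMap.range (taylorDiff k m 0)).comap
        (LinearMap.pi fun _ => LinearMap.id) := by
      refine Ideal.span_le.2 ?_
      rintro _ ⟨e, rfl⟩
      exact ⟨_, taylorDiff_zero_single k m e⟩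
    have h2 : f ⟨∅, Finset.card_empty⟩ ∈ monomialIdeal k m :=
      (Submodule.Quotient.mk_eq_zero _).1 hf
    have h3 : f = (LinearMap.pi fun _ => LinearMap.id :
        MvPolynomial V k →ₗ[MvPolynomial V k] (TaylorIndex r 0 → MvPolynomial V k))
          (f ⟨∅, Finset.card_empty⟩) := by
      ext1 ⟨σ, hσ⟩
      obtain rfl := Finset.card_eq_zero.1 hσ
      rfl
    rw [h3]
    exact h1 h2
  · rw [LinearMap.range_le_ker_iff]
    refine LinearMap.pi_ext' fun ⟨σ, hσ⟩ => LinearMap.ext_ring ?_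
    obtain ⟨e, rfl⟩ := Finset.card_eq_one.1 hσ
    rw [LinearMap.comp_apply, LinearMap.comp_apply, LinearMap.single_apply,
      taylorDiff_zero_single]
    exact (Submodule.Quotient.mk_eq_zero _).2 (Ideal.subset_span ⟨e, rfl⟩)

lemma taylorAug_surjective : Function.Surjective (taylorAug k m) := by
  intro y
  obtain ⟨p, rfl⟩ := Submodule.mkQ_surjective _ y
  exact ⟨fun _ => p, rfl⟩

lemma taylorAug_homogeneous (a : V →₀ ℕ) (f : TaylorIndex r 0 → MvPolynomial V k)
    (hf : f ∈ freePart k (fun σ : TaylorIndex r 0 => lcmExp m σ.1) a) :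
    taylorAug k m f ∈ quotPart (monomialIdeal k m) a := by
  have h0 : f ⟨∅, Finset.card_empty⟩ ∈ shiftPart k (lcmExp m ∅) a :=
    hf ⟨∅, Finset.card_empty⟩ trivial
  have h1 : shiftPart k (lcmExp m ∅) a = polyPart V k a := by
    unfold shiftPart polyPart
    congr 1
    ext p
    simp [lcmExp, bot_eq_zero]
  rw [h1] at h0
  exact Submodule.mem_map_of_mem (f := (Ideal.Quotient.mkₐ k (monomialIdeal k m)).toLinearMap) h0

/-- The Taylor resolution of a monomial ideal. -/
def taylorResolution : MultigradedFreeResolution.{u, v, 0} (monomialIdeal k m) where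
  ι n := TaylorIndex r n
  finite_ι n := inferInstance
  deg n σ := lcmExp m σ.1
  d n := taylorDiff k m n
  aug := taylorAug k m
  d_homogeneous n := taylorDiff_homogeneous k m n
  aug_homogeneous := taylorAug_homogeneous k m
  aug_surjective := taylorAug_surjective k m
  exact_zero := by exact taylorAug_exact k m
  exact_succ := by
    intro n
    exact taylorDiff_exact k m n

end Taylor

/-! ### The Taylor complex modulo the variables in the extremal degree `2 * i`. -/

section Diagonal

variable {V : Type u} (k : Type v) [Field k] {r : ℕ} {m : Fin r → V →₀ ℕ}

lemma eq_of_le_of_degree_eq {a b : V →₀ ℕ} (h : a ≤ b) (hd : a.degree = b.degree) : a = b := by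
  obtain ⟨c, rfl⟩ := exists_add_of_le h
  rw [map_add, left_eq_add, Finsupp.degree_eq_zero_iff] at hd
  rw [hd, add_zero]

lemma lcmExp_le_sum (σ : Finset (Fin r)) : lcmExp m σ ≤ ∑ e ∈ σ, m e :=
  Finset.sup_le fun _ he => Finset.single_le_sum (f := m) (fun _ _ => zero_le) he

lemma degree_sum (hm : ∀ e, (m e).degree = 2) (σ : Finset (Fin r)) :
    (∑ e ∈ σ, m e).degree = 2 * σ.card := by
  rw [map_sum, Finset.sum_congr rfl fun e _ => hm e, Finset.sum_const, smul_eq_mul, mul_comm]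

lemma degree_lcmExp_le (hm : ∀ e, (m e).degree = 2) (σ : Finset (Fin r)) :
    (lcmExp m σ).degree ≤ 2 * σ.card :=
  (Finsupp.degree_mono (lcmExp_le_sum σ)).trans (degree_sum hm σ).le

lemma lcmExp_eq_sum (hm : ∀ e, (m e).degree = 2) {σ : Finset (Fin r)}
    (h : (lcmExp m σ).degree = 2 * σ.card) : lcmExp m σ = ∑ e ∈ σ, m e :=
  eq_of_le_of_degree_eq (lcmExp_le_sum σ) (h.trans (degree_sum hm σ).symm)

/-- In the extremal degree at most one face of a simplex has the same multidegree. -/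
lemma eq_of_lcmExp_erase_eq (hm : ∀ e, (m e).degree = 2) (hinj : Function.Injective m)
    {τ : Finset (Fin r)} {e f : Fin r} (he : e ∈ τ) (hf : f ∈ τ)
    (hd : (lcmExp m τ).degree + 2 = 2 * τ.card)
    (he' : lcmExp m (τ.erase e) = lcmExp m τ) (hf' : lcmExp m (τ.erase f) = lcmExp m τ) :
    e = f := by
  -- Such a face itself has extremal degree, so its lcm is the product of its generators. This
  -- determines `m g` from `τ` alone.
  have key : ∀ g ∈ τ, lcmExp m (τ.erase g) = lcmExp m τ → lcmExp m τ + m g = ∑ e ∈ τ, m e := by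
    intro g hg hg'
    rw [← Finset.sum_erase_add _ _ hg, ← lcmExp_eq_sum hm, hg']
    rw [hg', Finset.card_erase_of_mem hg]
    omega
  exact hinj (add_left_cancel ((key e he he').trans (key f hf hf').symm))

-- The Taylor coefficients are signs times quotients of lcms; modulo the variables they survive only
-- where the two lcms agree.
open Classical in
lemma residueMap_taylorDiff_single (n : ℕ) (τ : TaylorIndex r (n + 1)) (ρ : TaylorIndex r n) :
    residueMap (taylorDiff k m n) (Pi.single τ (1 : k)) ρ =
      ∑ e ∈ τ.1, if τ.1.erase e = ρ.1 ∧ lcmExp m ρ.1 = lcmExp m τ.1 then faceSign k τ.1 e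
        else 0 := by
  have h1 : constVec V k _ (Pi.single τ (1 : k)) = Pi.single τ 1 := by
    ext1 σ
    rw [constVec_apply]
    by_cases h : σ = τ
    · subst h
      simp
    · simp [h]
  rw [residueMap_apply, residue_apply, h1, taylorDiff_single, taylorFaces, Finset.sum_apply,
    map_sum]
  refine Finset.sum_congr rfl fun e _ => ?_
  rw [Pi.smul_apply, constantCoeff_smul, taylorBasis]
  by_cases h : τ.1.erase e = ρ.1
  · have hle : lcmExp m ρ.1 ≤ lcmExp m τ.1 := h ▸ lcmExp_mono m (Finset.erase_subset e τ.1)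
    rw [h, Pi.single_eq_same, constantCoeff_monomial, smul_eq_mul, mul_ite, mul_one, mul_zero]
    refine if_congr ?_ rfl rfl
    rw [tsub_eq_zero_iff_le, eq_self_iff_true, true_and]
    exact ⟨fun h' => le_antisymm hle h', fun h' => h'.ge⟩
  · rw [Pi.single_eq_of_ne (Ne.symm h), map_zero, smul_zero, if_neg fun h' => h h'.1]

lemma residueMap_taylorDiff_apply (n : ℕ) (x : TaylorIndex r (n + 1) → k) (ρ : TaylorIndex r n) :
    residueMap (taylorDiff k m n) x ρ =
      ∑ τ, x τ * residueMap (taylorDiff k m n) (Pi.single τ (1 : k)) ρ := by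
  conv_lhs => rw [← Finset.univ_sum_single x, map_sum, Finset.sum_apply]
  refine Finset.sum_congr rfl fun τ _ => ?_
  rw [← smul_eq_mul, ← Pi.smul_apply, ← map_smul, ← Pi.single_smul, smul_eq_mul, mul_one]

/-- An extremal simplex which is a proper face in the same multidegree is a boundary. -/
lemma single_mem_range_taylorDiff (hm : ∀ e, (m e).degree = 2) (hinj : Function.Injective m)
    {i : ℕ} (σ : TaylorIndex r i) (hσ : (lcmExp m σ.1).degree = 2 * i) {e : Fin r} (he : e ∉ σ.1)
    (hle : m e ≤ lcmExp m σ.1) :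
    Pi.single σ (1 : k) ∈ LinearMap.range (residueMap (taylorDiff k m i)) := by
  classical
  have hcard : (insert e σ.1).card = i + 1 := by rw [Finset.card_insert_of_notMem he, σ.2]
  have hlcm : lcmExp m (insert e σ.1) = lcmExp m σ.1 :=
    le_antisymm (lcmExp_insert_le m hle le_rfl) (lcmExp_mono m (Finset.subset_insert e σ.1))
  have herase : (insert e σ.1).erase e = σ.1 := Finset.erase_insert he
  -- Adding `e` leaves the lcm unchanged, so `σ` is the unique face that survives, and the reduced
  -- boundary is a signed basis vector.
  have key : residueMap (taylorDiff k m i) (Pi.single ⟨insert e σ.1, hcard⟩ (1 : k)) =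
      Pi.single σ (faceSign k (insert e σ.1) e) := by
    ext1 ρ
    rw [residueMap_taylorDiff_single, Finset.sum_eq_single e]
    · rw [herase]
      by_cases h : ρ = σ
      · subst h
        rw [Pi.single_eq_same, if_pos ⟨rfl, hlcm.symm⟩]
      · rw [Pi.single_eq_of_ne h, if_neg fun h' => h (Subtype.ext h'.1.symm)]
    · intro f hf hne
      refine if_neg fun h => hne ?_
      refine eq_of_lcmExp_erase_eq hm hinj hf (Finset.mem_insert_self e σ.1) ?_ (h.1 ▸ h.2) ?_
      · rw [hlcm, hσ, hcard]
        ring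
      · rw [herase, hlcm]
    · intro h
      exact absurd (Finset.mem_insert_self e σ.1) h
  refine ⟨(faceSign k (insert e σ.1) e)⁻¹ • Pi.single ⟨insert e σ.1, hcard⟩ (1 : k), ?_⟩
  rw [map_smul, key, ← Pi.single_smul, smul_eq_mul, inv_mul_cancel₀ (faceSign_ne_zero k _ _)]

lemma residuePart_inf_range_taylorDiff (hm : ∀ e, (m e).degree = 2) (hinj : Function.Injective m)
    {i : ℕ} {a : V →₀ ℕ} (ha : a.degree = 2 * i) :
    residuePart k (fun σ : TaylorIndex r i => lcmExp m σ.1) a ⊓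
        LinearMap.range (residueMap (taylorDiff k m i)) =
      coordSubspace k fun σ => lcmExp m σ.1 = a ∧ ∃ e ∉ σ.1, m e ≤ lcmExp m σ.1 := by
  classical
  apply le_antisymm
  · rintro _ ⟨hx, y, rfl⟩ σ hσ
    refine ⟨hx σ hσ, ?_⟩
    rw [residueMap_taylorDiff_apply] at hσ
    -- A nonzero coefficient at `σ` comes from some `τ` with `σ` as a face and the same lcm; the
    -- vertex removed from `τ` is the required `e`.
    obtain ⟨τ, -, hτ⟩ := Finset.exists_ne_zero_of_sum_ne_zero hσ
    have h := right_ne_zero_of_mul hτ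
    rw [residueMap_taylorDiff_single] at h
    obtain ⟨e, he, h⟩ := Finset.exists_ne_zero_of_sum_ne_zero h
    obtain ⟨h1, h2⟩ := (ite_ne_right_iff.1 h).1
    refine ⟨e, h1 ▸ Finset.notMem_erase e τ.1, ?_⟩
    rw [h2]
    exact le_lcmExp m he
  · intro x hx
    refine ⟨fun σ hσ => (hx σ hσ).1, ?_⟩
    rw [SetLike.mem_coe, ← Finset.univ_sum_single x]
    refine Submodule.sum_mem _ fun σ _ => ?_
    by_cases h : x σ = 0
    · rw [h, Pi.single_zero]
      exact zero_mem _
    · obtain ⟨hσ, e, he, hle⟩ := hx σ h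
      rw [← mul_one (x σ), ← smul_eq_mul, Pi.single_smul]
      exact Submodule.smul_mem _ _
        (single_mem_range_taylorDiff k hm hinj σ (by rw [hσ, ha]) he hle)

/-- The lcm of `i - 1` quadratic monomials has degree less than `2 * i`, so the differential has
zero target in multidegree `a`. -/
lemma taylor_resCyclesPart (hm : ∀ e, (m e).degree = 2) {i : ℕ} {a : V →₀ ℕ}
    (ha : a.degree = 2 * i) : (taylorResolution k m).resCyclesPart i a =
      residuePart k (fun σ : TaylorIndex r i => lcmExp m σ.1) a := by
  refine inf_eq_right.2 fun x hx => ?_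
  cases i with
  | zero => trivial
  | succ n =>
    refine LinearMap.mem_ker.2 (funext fun ρ => ?_)
    by_contra h
    have h1 : lcmExp m ρ.1 = a :=
      (taylorDiff_homogeneous k m n).residueMap_mem hx ρ h
    have h2 := degree_lcmExp_le hm ρ.1
    rw [h1, ha, ρ.2] at h2
    omega

-- Cycles and boundaries are both coordinate subspaces here, so the dimension of the quotient counts
-- the remaining basis vectors.
open Classical in
lemma taylor_multigradedBetti (hm : ∀ e, (m e).degree = 2) (hinj : Function.Injective m) {i : ℕ}
    {a : V →₀ ℕ} (ha : a.degree = 2 * i) : (taylorResolution k m).multigradedBetti i a =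
      (Finset.univ.filter fun σ : TaylorIndex r i =>
        lcmExp m σ.1 = a ∧ ∀ e, m e ≤ lcmExp m σ.1 → e ∈ σ.1).card := by
  rw [MultigradedFreeResolution.multigradedBetti_eq, taylor_resCyclesPart k hm ha]
  have h := finrank_map_add_finrank_inf_ker
    (residuePart k (fun σ : TaylorIndex r i => lcmExp m σ.1) a)
    (LinearMap.range (residueMap (taylorDiff k m i))).mkQ
  rw [Submodule.ker_mkQ, residuePart_inf_range_taylorDiff k hm hinj ha, residuePart,
    finrank_coordSubspace, finrank_coordSubspace] at h
  have h' := Finset.card_filter_add_card_filter_not (s := Finset.univ.filter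
    fun σ : TaylorIndex r i => lcmExp m σ.1 = a) (fun σ => ∃ e ∉ σ.1, m e ≤ lcmExp m σ.1)
  rw [Finset.filter_filter] at h'
  have h'' : (Finset.univ.filter fun σ : TaylorIndex r i =>
      lcmExp m σ.1 = a ∧ ∀ e, m e ≤ lcmExp m σ.1 → e ∈ σ.1) =
      (Finset.univ.filter fun σ : TaylorIndex r i => lcmExp m σ.1 = a).filter
        fun σ => ¬∃ e ∉ σ.1, m e ≤ lcmExp m σ.1 := by
    rw [Finset.filter_filter]
    congr 1
    ext σ
    push Not
    simp only [not_imp_not]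
  rw [h'']
  change Module.finrank k ((coordSubspace k fun σ : TaylorIndex r i => lcmExp m σ.1 = a).map
    (LinearMap.range (residueMap (taylorDiff k m i))).mkQ) = _
  omega

open Classical in
lemma taylor_gradedBetti [Fintype V] [DecidableEq V] (hm : ∀ e, (m e).degree = 2)
    (hinj : Function.Injective m) (i : ℕ) : (taylorResolution k m).gradedBetti i (2 * i) =
      (Finset.univ.filter fun σ : TaylorIndex r i =>
        (lcmExp m σ.1).degree = 2 * i ∧ ∀ e, m e ≤ lcmExp m σ.1 → e ∈ σ.1).card := by
  rw [MultigradedFreeResolution.gradedBetti, Finset.card_eq_sum_card_fiberwise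
    (f := fun σ : TaylorIndex r i => lcmExp m σ.1)
    (t := (Finset.univ : Finset V).finsuppAntidiag (2 * i))]
  · refine Finset.sum_congr rfl fun a ha => ?_
    have ha' : a.degree = 2 * i := by
      rw [Finsupp.degree_eq_sum]
      exact (Finset.mem_finsuppAntidiag.1 ha).1
    rw [taylor_multigradedBetti k hm hinj ha', Finset.filter_filter]
    congr 1
    ext σ
    simp only [Finset.mem_filter, Finset.mem_univ, true_and]
    constructor
    · rintro ⟨rfl, h⟩
      exact ⟨⟨ha', h⟩, rfl⟩
    · rintro ⟨⟨-, h⟩, rfl⟩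
      exact ⟨rfl, h⟩
  · intro σ hσ
    simp only [Finset.coe_filter, Finset.mem_univ, true_and, Set.mem_ofPred_eq] at hσ
    rw [SetLike.mem_coe, Finset.mem_finsuppAntidiag, ← hσ.1, Finsupp.degree_eq_sum]
    exact ⟨rfl, Finset.subset_univ _⟩

end Diagonal

/-! ### Translation into induced matchings of the graph. -/

section Graph

variable {V : Type u}

/-- The exponent vector of `x_u x_v` for `s(u, v)`. -/
def edgeExp (s : Sym2 V) : V →₀ ℕ :=
  s.lift ⟨fun x y => Finsupp.single x 1 + Finsupp.single y 1, fun _ _ => add_comm _ _⟩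

@[simp]
lemma edgeExp_mk (x y : V) : edgeExp s(x, y) = Finsupp.single x 1 + Finsupp.single y 1 := rfl

lemma degree_edgeExp (s : Sym2 V) : (edgeExp s).degree = 2 := by
  induction s with
  | _ x y => rw [edgeExp_mk, map_add, Finsupp.degree_single, Finsupp.degree_single]

lemma edgeExp_apply_ne_zero {s : Sym2 V} {v : V} : edgeExp s v ≠ 0 ↔ v ∈ s := by
  classical
  induction s with
  | _ x y =>
    rw [edgeExp_mk, Finsupp.add_apply, Finsupp.single_apply, Finsupp.single_apply, Sym2.mem_iff,
      @eq_comm _ v x, @eq_comm _ v y]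
    split_ifs with h1 h2 h2 <;> simp [h1, h2]

lemma edgeExp_apply_le_one {s : Sym2 V} (hs : ¬s.IsDiag) (v : V) : edgeExp s v ≤ 1 := by
  classical
  induction s with
  | _ x y =>
    rw [Sym2.mk_isDiag_iff] at hs
    rw [edgeExp_mk, Finsupp.add_apply, Finsupp.single_apply, Finsupp.single_apply]
    split_ifs with h1 h2 h2
    · exact absurd (h1.trans h2.symm) hs
    all_goals omega

lemma edgeExp_injective : Function.Injective (edgeExp (V := V)) := by
  intro s t h
  refine Sym2.ext fun v => ?_
  rw [← edgeExp_apply_ne_zero, ← edgeExp_apply_ne_zero, h]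

variable {G : SimpleGraph V} {r : ℕ} (e : Fin r ≃ G.edgeSet)

/-- The exponent vectors of the generators of the edge ideal. -/
def edgeExps (j : Fin r) : V →₀ ℕ := edgeExp (e j).1

lemma edgeExps_injective : Function.Injective (edgeExps e) :=
  edgeExp_injective.comp (Subtype.val_injective.comp e.injective)

lemma edgeExps_apply_ne_zero {j : Fin r} {v : V} : edgeExps e j v ≠ 0 ↔ v ∈ (e j).1 :=
  edgeExp_apply_ne_zero

lemma edgeExps_apply_le_one (j : Fin r) (v : V) : edgeExps e j v ≤ 1 :=
  edgeExp_apply_le_one (G.not_isDiag_of_mem_edgeSet (e j).2) v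

lemma edgeIdeal_eq_monomialIdeal (k : Type v) [Field k] :
    edgeIdeal k G = monomialIdeal k (edgeExps e) := by
  unfold edgeIdeal monomialIdeal
  congr 1
  have hX : ∀ x y : V, (X x * X y : MvPolynomial V k) = monomial (edgeExp s(x, y)) 1 := by
    intro x y
    simp [X, monomial_mul]
  ext p
  constructor
  · rintro ⟨x, y, hxy, rfl⟩
    refine ⟨e.symm ⟨s(x, y), hxy⟩, ?_⟩
    rw [hX]
    simp only [edgeExps, Equiv.apply_symm_apply]
  · rintro ⟨j, rfl⟩
    rcases h : e j with ⟨s, hs⟩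
    induction s with
    | _ x y =>
      refine ⟨x, y, hs, ?_⟩
      rw [hX]
      simp only [edgeExps, h]

lemma lcmExp_edgeExps_apply_ne_zero {σ : Finset (Fin r)} {v : V} :
    lcmExp (edgeExps e) σ v ≠ 0 ↔ ∃ j ∈ σ, v ∈ (e j).1 := by
  constructor
  · intro h
    -- The lcm divides the product, so a variable in the lcm occurs in one of the factors.
    have h1 : (∑ j ∈ σ, edgeExps e j) v ≠ 0 := by
      have := lcmExp_le_sum (m := edgeExps e) σ v
      omega
    rw [Finsupp.finsetSum_apply] at h1
    obtain ⟨j, hj, h⟩ := Finset.exists_ne_zero_of_sum_ne_zero h1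
    exact ⟨j, hj, (edgeExps_apply_ne_zero e).1 h⟩
  · rintro ⟨j, hj, hv⟩
    have h1 := le_lcmExp (edgeExps e) hj v
    have h2 := (edgeExps_apply_ne_zero e).2 hv
    omega

/-- Edge monomials are squarefree, so divisibility only compares supports. -/
lemma edgeExps_le_lcmExp_iff {σ : Finset (Fin r)} {j : Fin r} :
    edgeExps e j ≤ lcmExp (edgeExps e) σ ↔ ∀ v ∈ (e j).1, ∃ f ∈ σ, v ∈ (e f).1 := by
  rw [Finsupp.le_def]
  refine forall_congr' fun v => ?_
  rw [← lcmExp_edgeExps_apply_ne_zero, ← edgeExps_apply_ne_zero]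
  have := edgeExps_apply_le_one e j v
  omega

lemma degree_lcmExp_edgeExps_iff [Finite V] {σ : Finset (Fin r)} :
    (lcmExp (edgeExps e) σ).degree = 2 * σ.card ↔
      ∀ j ∈ σ, ∀ f ∈ σ, ∀ v, v ∈ (e j).1 → v ∈ (e f).1 → j = f := by
  classical
  constructor
  · intro h j hj f hf v hvj hvf
    by_contra hne
    have h1 := lcmExp_eq_sum (fun j => degree_edgeExp (e j).1) h
    -- The lcm is squarefree and equals the product by `h1`, so no variable can occur in two
    -- factors.
    have h2 : lcmExp (edgeExps e) σ ≤ Finsupp.equivFunOnFinite.symm fun _ => 1 :=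
      Finset.sup_le fun j _ v => edgeExps_apply_le_one e j v
    have h3 : ∑ j ∈ σ, edgeExps e j v ≤ 1 := by
      rw [← Finsupp.finsetSum_apply]
      exact h1 ▸ h2 v
    have h4 := Finset.add_le_sum (f := fun j => edgeExps e j v) (fun _ _ => Nat.zero_le _) hj hf hne
    have h5 := (edgeExps_apply_ne_zero e).2 hvj
    have h6 := (edgeExps_apply_ne_zero e).2 hvf
    omega
  · intro h
    rw [← degree_sum (m := edgeExps e) fun j => degree_edgeExp (e j).1]
    congr 1
    refine le_antisymm (lcmExp_le_sum σ) fun v => ?_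
    rw [Finsupp.finsetSum_apply]
    by_cases hv : ∃ j ∈ σ, v ∈ (e j).1
    · obtain ⟨j, hj, hv⟩ := hv
      rw [Finset.sum_eq_single_of_mem j hj]
      · exact le_lcmExp (edgeExps e) hj v
      · intro f hf hne
        by_contra h0
        exact hne (h f hf j hj v ((edgeExps_apply_ne_zero e).1 h0) hv)
    · rw [Finset.sum_eq_zero]
      · exact Nat.zero_le _
      · intro j hj
        by_contra h0
        exact hv ⟨j, hj, (edgeExps_apply_ne_zero e).1 h0⟩

/-- The subgraph formed by a set of edges and their endpoints. -/
def edgesSubgraph (σ : Finset (Fin r)) : G.Subgraph where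
  verts := {v | ∃ j ∈ σ, v ∈ (e j).1}
  Adj x y := ∃ j ∈ σ, (e j).1 = s(x, y)
  adj_sub := by
    rintro x y ⟨j, -, h⟩
    rw [← SimpleGraph.mem_edgeSet, ← h]
    exact (e j).2
  edge_vert := by
    rintro x y ⟨j, hj, h⟩
    exact ⟨j, hj, h ▸ Sym2.mem_mk_left x y⟩
  symm := by
    refine ⟨?_⟩
    rintro x y ⟨j, hj, h⟩
    exact ⟨j, hj, h.trans Sym2.eq_swap⟩

lemma mem_edgeSet_edgesSubgraph {σ : Finset (Fin r)} {s : Sym2 V} :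
    s ∈ (edgesSubgraph e σ).edgeSet ↔ ∃ j ∈ σ, (e j).1 = s := by
  induction s with
  | _ x y => rfl

lemma edgesSubgraph_injective : Function.Injective (edgesSubgraph e) := by
  intro σ τ h
  ext j
  have h1 : (e j).1 ∈ (edgesSubgraph e σ).edgeSet ↔ (e j).1 ∈ (edgesSubgraph e τ).edgeSet := by
    rw [h]
  simpa [mem_edgeSet_edgesSubgraph, Subtype.val_inj] using h1

lemma ncard_edgeSet_edgesSubgraph (σ : Finset (Fin r)) :
    (edgesSubgraph e σ).edgeSet.ncard = σ.card := by
  have h : (edgesSubgraph e σ).edgeSet = (fun j => (e j).1) '' (σ : Set (Fin r)) := by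
    ext s
    exact mem_edgeSet_edgesSubgraph e
  have hinj : Function.Injective fun j => (e j).1 := Subtype.val_injective.comp e.injective
  rw [h, Set.ncard_image_of_injective _ hinj, Set.ncard_coe_finset]

/-- Every vertex of `edgesSubgraph` lies on a chosen edge by construction, so only uniqueness of
that edge is at stake. -/
lemma isMatching_edgesSubgraph_iff {σ : Finset (Fin r)} :
    (edgesSubgraph e σ).IsMatching ↔
      ∀ j ∈ σ, ∀ f ∈ σ, ∀ v, v ∈ (e j).1 → v ∈ (e f).1 → j = f := by
  constructor
  · intro h j hj f hf v hvj hvf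
    obtain ⟨x, hx⟩ := Sym2.mem_iff_exists.1 hvj
    obtain ⟨y, hy⟩ := Sym2.mem_iff_exists.1 hvf
    have hxy : x = y := (h ⟨j, hj, hvj⟩).unique ⟨j, hj, hx⟩ ⟨f, hf, hy⟩
    exact e.injective (Subtype.ext (by rw [hx, hy, hxy]))
  · rintro h v ⟨j, hj, hv⟩
    obtain ⟨x, hx⟩ := Sym2.mem_iff_exists.1 hv
    refine ⟨x, ⟨j, hj, hx⟩, ?_⟩
    rintro y ⟨f, hf, hy⟩
    obtain rfl := h j hj f hf v hv (hy ▸ Sym2.mem_mk_left v y)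
    exact Sym2.congr_right.1 (hy.symm.trans hx)

lemma isInduced_edgesSubgraph_iff {σ : Finset (Fin r)} :
    (edgesSubgraph e σ).IsInduced ↔
      ∀ j, edgeExps e j ≤ lcmExp (edgeExps e) σ → j ∈ σ := by
  simp only [edgeExps_le_lcmExp_iff]
  constructor
  · intro h j hj
    rcases hej : e j with ⟨s, hs⟩
    rw [hej] at hj
    induction s with
    | _ x y =>
      obtain ⟨f, hf, hfj⟩ := h (hj x (Sym2.mem_mk_left x y)) (hj y (Sym2.mem_mk_right x y)) hs
      have : f = j := e.injective (Subtype.ext (by rw [hfj, hej]))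
      exact this ▸ hf
  · intro h x hx y hy hxy
    refine ⟨e.symm ⟨s(x, y), hxy⟩, h _ fun v hv => ?_, by rw [Equiv.apply_symm_apply]⟩
    rw [Equiv.apply_symm_apply] at hv
    rcases Sym2.mem_iff.1 hv with rfl | rfl
    · exact hx
    · exact hy

/-- A matching has no isolated vertices, so it is determined by its edges. -/
lemma exists_edgesSubgraph_eq {H : G.Subgraph} (hH : H.IsMatching) :
    ∃ σ, edgesSubgraph e σ = H := by
  classical
  have hadj : ∀ x y, (edgesSubgraph e (Finset.univ.filter fun j => (e j).1 ∈ H.edgeSet)).Adj x y ↔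
      H.Adj x y := by
    intro x y
    constructor
    · rintro ⟨j, hj, h⟩
      rw [Finset.mem_filter, h] at hj
      exact hj.2
    · intro h
      exact ⟨e.symm ⟨s(x, y), H.adj_sub h⟩, by simpa using h, by rw [Equiv.apply_symm_apply]⟩
  refine ⟨Finset.univ.filter fun j => (e j).1 ∈ H.edgeSet, SimpleGraph.Subgraph.ext (Set.ext fun v => ⟨?_, fun hv => ?_⟩) ?_⟩
  · rintro ⟨j, hj, hv⟩
    exact H.mem_verts_of_mem_edge (Finset.mem_filter.1 hj).2 hv
  · obtain ⟨x, hx, -⟩ := hH hv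
    exact ((hadj v x).2 hx).fst_mem
  · ext x y
    exact hadj x y

open Classical in
lemma card_eq_ncard_inducedDisjointEdges [Finite V] (i : ℕ) :
    (Finset.univ.filter fun σ : TaylorIndex r i => (lcmExp (edgeExps e) σ.1).degree = 2 * i ∧
      ∀ j, edgeExps e j ≤ lcmExp (edgeExps e) σ.1 → j ∈ σ.1).card =
      (inducedDisjointEdges G i).ncard := by
  have h : ∀ σ : TaylorIndex r i, ((lcmExp (edgeExps e) σ.1).degree = 2 * i ∧
      ∀ j, edgeExps e j ≤ lcmExp (edgeExps e) σ.1 → j ∈ σ.1) ↔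
        edgesSubgraph e σ.1 ∈ inducedDisjointEdges G i := by
    rintro ⟨σ, rfl⟩
    rw [degree_lcmExp_edgeExps_iff, ← isMatching_edgesSubgraph_iff,
      ← isInduced_edgesSubgraph_iff, inducedDisjointEdges, Set.mem_ofPred_eq,
      ncard_edgeSet_edgesSubgraph]
    tauto
  have himage : inducedDisjointEdges G i = (fun σ : TaylorIndex r i => edgesSubgraph e σ.1) ''
      (Finset.univ.filter fun σ : TaylorIndex r i => (lcmExp (edgeExps e) σ.1).degree = 2 * i ∧
        ∀ j, edgeExps e j ≤ lcmExp (edgeExps e) σ.1 → j ∈ σ.1 : Finset (TaylorIndex r i)) := by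
    ext H
    constructor
    · intro hH
      obtain ⟨σ, rfl⟩ := exists_edgesSubgraph_eq e hH.2.1
      have hσ : σ.card = i := (ncard_edgeSet_edgesSubgraph e σ).symm.trans hH.2.2
      exact ⟨⟨σ, hσ⟩, Finset.mem_filter.2 ⟨Finset.mem_univ _, (h ⟨σ, hσ⟩).2 hH⟩, rfl⟩
    · rintro ⟨σ, hσ, rfl⟩
      exact (h σ).1 (Finset.mem_filter.1 hσ).2
  have hinj : Function.Injective fun σ : TaylorIndex r i => edgesSubgraph e σ.1 :=
    (edgesSubgraph_injective e).comp Subtype.val_injective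
  rw [himage, Set.ncard_image_of_injective _ hinj, Set.ncard_coe_finset]

end Graph

/-! ### Conclusion for an arbitrary resolution of the edge ideal. -/

namespace MultigradedFreeResolution

theorem gradedBetti_edgeIdeal {V : Type u} [Fintype V] [DecidableEq V] {k : Type v} [Field k]
    {G : SimpleGraph V} (F : MultigradedFreeResolution.{u, v, w} (edgeIdeal k G)) (i : ℕ) :
    F.gradedBetti i (2 * i) = (inducedDisjointEdges G i).ncard := by
  obtain ⟨r, ⟨e⟩⟩ := Finite.exists_equiv_fin G.edgeSet
  have hI := edgeIdeal_homogeneous (k := k) G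
  rw [← card_eq_ncard_inducedDisjointEdges e.symm i, ← taylor_gradedBetti k
    (m := edgeExps e.symm) (fun j => degree_edgeExp (e.symm j).1) (edgeExps_injective e.symm) i]
  -- The type of `F` depends on the ideal, so `F` is generalized before `edgeIdeal` is replaced by
  -- the monomial ideal that the Taylor complex resolves.
  revert F hI
  rw [edgeIdeal_eq_monomialIdeal e.symm]
  intro F hI
  exact Finset.sum_congr rfl fun a _ => F.multigradedBetti_eq_of_resolution _ hI i a

end MultigradedFreeResolution

end GraphBetti

end

theorem mainTheorem10 {V : Type*} [Fintype V] [DecidableEq V] (k : Type*) [Field k]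
    (G : SimpleGraph V) (i : ℕ) (hi : 1 ≤ i) :
    GraphBetti.graphBetti k G i (2 * i) = (GraphBetti.inducedDisjointEdges G i).ncard ∧
      ∀ F : GraphBetti.MultigradedFreeResolution (GraphBetti.edgeIdeal k G),
        F.gradedBetti i (2 * i) = (GraphBetti.inducedDisjointEdges G i).ncard :=
  ⟨GraphBetti.MultigradedFreeResolution.gradedBetti_edgeIdeal _ i,
    fun F => F.gradedBetti_edgeIdeal i⟩
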